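/- For measurable $2\pi$-periodic $f$ let $\|f\|_p=\big(\int_0^{2\pi}|f(t)|^p\,dt\big)^{1/p}$ if $1\le p<\infty$ and $\|f\|_\infty=\operatorname{ess\,sup}|f|$; put $1/\infty=0$. For $r>1$ and a real sequence $\bar\beta=(\beta_k)_{k\ge1}$ let $W^r_{\bar\beta,1}$ (Weyl–Nagy class) be the set of functions $$f(x)=\frac{a_0}{2}+\frac1\pi\int_0^{2\pi}\Psi(x-t)\varphi(t)\,dt,\qquad \Psi(t)=\sum_{k=1}^\infty k^{-r}\cos\Big(kt-\frac{\pi\beta_k}{2}\Big),$$ where $a_0\in\mathbb R$ and $\varphi$ is a real $2\pi$-periodic function with $\|\varphi\|_1\le1$ and $\int_0^{2\pi}\varphi(t)\,dt=0$. For $n\in\mathbb N=\{1,2,\dots\}$ and a continuous $2\pi$-periodic $f$ let $\tilde S_{n-1}(f;\cdot)$ be the trigonometric polynomial of order $n-1$ that interpolates $f$ at the points $\frac{2k\pi}{2n-1}$, $k\in\mathbb Z$, and put $$\tilde{\mathcal E}_n(W^r_{\bar\beta,1})_{L_p}=\sup_{f\in W^r_{\bar\beta,1}}\big\|f-\tilde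 S_{n-1}(f;\cdot)\big\|_p,\qquad c_p=\frac{2^{1-1/p}}{\pi^{1+1/p}}\|\cos t\|_p^2 .$$ Theorem. For all $1\le p\le\infty$, $r>1$, $\bar\beta$ and $n\in\mathbb N$ the quantity $\tilde{\mathcal E}_n(W^r_{\bar\beta,1})_{L_p}$ is finite and $$\tilde{\mathcal E}_n(W^r_{\bar\beta,1})_{L_p}=\frac1{n^r}\Big(c_p+O(1)\Big(\frac1n+e^{-r/(n+1)}\Big(1+\frac{n}{r-1}\Big)\Big)\Big).$$ If $r\ge n+1$, then $$\tilde{\mathcal E}_n(W^r_{\bar\beta,1})_{L_p}=\frac1{n^r}\Big(c_p+O(1)\Big(\frac1n+e^{-r/(n+1)}\Big)\Big),$$ and, for $p=1$, $$\tilde{\mathcal E}_n(W^r_{\bar\beta,1})_{L_1}=\frac1{n^r}\Big(\frac{16}{\pi^2}+O(1)\Big(\frac1n+e^{-r/(n+1)}\Big)\Big).$$ In all three formulas $|O(1)|\le C$ with one absolute constant $C$ (independent of $p$, $r$, $\bar\beta$, $n$). Consequently, if $r=r_n>1$ and $r_n/n\to\infty$ as $n\to\infty$, then, for $p=p_n\in[1,\infty]$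 and $\bar\beta=\bar\beta^{(n)}$ that may depend on $n$ in any way, $$\tilde{\mathcal E}_n(W^{r_n}_{\bar\beta,1})_{L_p}\sim n^{-r_n}c_p\quad(n\to\infty),$$ and in particular $\tilde{\mathcal E}_n(W^{r_n}_{\bar\beta,1})_{L_1}\sim\frac{16}{\pi^2}\,n^{-r_n}$. -/

import Mathlib

open MeasureTheory Filter Topology
open scoped ENNReal

noncomputable section

namespace TrigInterp

/-- Lebesgue measure on one period; for `2π`-periodic functions the norm of `L_p` is
`eLpNorm · p periodMeasure` (not normalised; the essential supremum for `p = ∞`). -/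
def periodMeasure : Measure ℝ := volume.restrict (Set.Ioc 0 (2 * Real.pi))

/-- The kernel `Ψ(t) = ∑_{k ≥ 1} ψ(k) cos (k t - π β_k / 2)`.  The values `ψ 0`, `β 0` play no role. -/
def kernel (ψ β : ℕ → ℝ) (t : ℝ) : ℝ :=
  ∑' k : ℕ, ψ (k + 1) * Real.cos (((k + 1 : ℕ) : ℝ) * t - Real.pi * β (k + 1) / 2)

/-- The class of convolutions
`f(x) = a₀ / 2 + (1 / π) ∫_0^{2π} Ψ(x - t) φ(t) dt`, with `a₀` real and `φ` a `2π`-periodic function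
of the unit ball of `L_1` that is orthogonal to constants. -/
def convClass (ψ β : ℕ → ℝ) : Set (ℝ → ℝ) :=
  {f | ∃ (a₀ : ℝ) (φ : ℝ → ℝ),
      Function.Periodic φ (2 * Real.pi) ∧ MemLp φ 1 periodMeasure ∧
      eLpNorm φ 1 periodMeasure ≤ 1 ∧ ∫ t in (0 : ℝ)..(2 * Real.pi), φ t = 0 ∧
      ∀ x, f x = a₀ / 2 +
        (1 / Real.pi) * ∫ t in (0 : ℝ)..(2 * Real.pi), kernel ψ β (x - t) * φ t}

/-- The Weyl–Nagy class: `ψ(k) = k^{-r}`. -/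
def weylNagyClass (r : ℝ) (β : ℕ → ℝ) : Set (ℝ → ℝ) :=
  convClass (fun k => (k : ℝ) ^ (-r)) β

/-- Real trigonometric polynomials of order at most `m`. -/
def IsTrigPoly (m : ℕ) (T : ℝ → ℝ) : Prop :=
  ∃ a b : ℕ → ℝ, ∀ x, T x = a 0 / 2 +
    ∑ k ∈ Finset.Icc 1 m, (a k * Real.cos (k * x) + b k * Real.sin (k * x))

/-- The interpolation nodes `2 k π / (2 n - 1)`. -/
def node (n : ℕ) (k : ℤ) : ℝ := 2 * k * Real.pi / (2 * n - 1)

/-- `T` is a trigonometric polynomial of order `n - 1` that takes the values of `f` at all nodes. -/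
def IsTrigInterp (n : ℕ) (f T : ℝ → ℝ) : Prop :=
  IsTrigPoly (n - 1) T ∧ ∀ k : ℤ, T (node n k) = f (node n k)

/-- The Dirichlet kernel `1/2 + ∑_{k=1}^{n-1} cos k x` of order `n - 1`. -/
def dirichlet (n : ℕ) (x : ℝ) : ℝ := 1 / 2 + ∑ k ∈ Finset.Icc 1 (n - 1), Real.cos (k * x)

/-- The interpolation polynomial of order `n - 1` of `f` in Lagrange form.  For `n ≥ 1` and `f` of
period `2π` it is the unique `T` with `IsTrigInterp n f T`: see `isTrigInterp_iff` below. -/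
def interpPoly (n : ℕ) (f : ℝ → ℝ) (x : ℝ) : ℝ :=
  2 / (2 * n - 1) * ∑ j ∈ Finset.range (2 * n - 1), f (node n j) * dirichlet n (x - node n j)

theorem two_sin_mul_dirichlet (m : ℕ) (x : ℝ) :
    2 * Real.sin (x / 2) * dirichlet (m + 1) x = Real.sin ((m + 1 / 2) * x) := by
  induction m with
  | zero =>
    simp only [dirichlet, Nat.cast_zero]
    norm_num
    ring_nf
  | succ k ih =>
    have h1 : dirichlet (k + 1 + 1) x = dirichlet (k + 1) x + Real.cos ((k + 1) * x) := by
      simp only [dirichlet, Nat.add_sub_cancel]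
      rw [Finset.sum_Icc_succ_top (by omega)]
      push_cast
      ring
    rw [h1, mul_add, ih]
    have e1 : ((k : ℝ) + 1 / 2) * x = (k + 1) * x - x / 2 := by ring
    have e2 : (((k + 1 : ℕ) : ℝ) + 1 / 2) * x = (k + 1) * x + x / 2 := by push_cast; ring
    rw [e1, e2, Real.sin_sub, Real.sin_add]
    ring

theorem dirichlet_node_sub (m : ℕ) (i j : ℕ) (hi : i < 2 * (m + 1) - 1)
    (hj : j < 2 * (m + 1) - 1) :
    dirichlet (m + 1) (node (m + 1) i - node (m + 1) j) =
      if i = j then (2 * (m : ℝ) + 1) / 2 else 0 := by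
  split_ifs with h
  · subst h
    simp [dirichlet]
    ring
  · have hN : (2 * (m : ℝ) + 1) ≠ 0 := by positivity
    have hx : node (m + 1) i - node (m + 1) j
        = 2 * (Real.pi * ((i : ℝ) - j) / (2 * m + 1)) := by
      simp only [node]
      push_cast
      rw [show (2 * ((m : ℝ) + 1) - 1) = 2 * m + 1 by ring]
      ring
    have key := two_sin_mul_dirichlet m (node (m + 1) i - node (m + 1) j)
    have hz : Real.sin (((m : ℝ) + 1 / 2) * (node (m + 1) i - node (m + 1) j)) = 0 := by
      rw [hx, show ((m : ℝ) + 1 / 2) * (2 * (Real.pi * ((i : ℝ) - j) / (2 * m + 1)))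
        = (((i : ℤ) - (j : ℤ) : ℤ) : ℝ) * Real.pi by push_cast; field_simp]
      exact Real.sin_int_mul_pi _
    have hnz : Real.sin ((node (m + 1) i - node (m + 1) j) / 2) ≠ 0 := by
      rw [hx, mul_div_cancel_left₀ _ (two_ne_zero)]
      intro h0
      rw [Real.sin_eq_zero_iff] at h0
      obtain ⟨q, hq⟩ := h0
      have h1 : (q : ℝ) * (2 * m + 1) = (i : ℝ) - j := by
        field_simp at hq
        have := Real.pi_ne_zero
        nlinarith [hq]
      have h2 : q * (2 * (m : ℤ) + 1) = (i : ℤ) - j := by exact_mod_cast h1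
      have h3 : (2 * (m : ℤ) + 1) ∣ ((i : ℤ) - j) := ⟨q, by rw [← h2]; ring⟩
      have h4 := Int.eq_zero_of_abs_lt_dvd h3 (by rw [abs_lt]; constructor <;> omega)
      omega
    rw [hz] at key
    rcases mul_eq_zero.mp key with h5 | h5
    · exact absurd h5 (mul_ne_zero two_ne_zero hnz)
    · exact h5

theorem isTrigPoly_interpPoly (n : ℕ) (f : ℝ → ℝ) : IsTrigPoly (n - 1) (interpPoly n f) := by
  refine ⟨fun k => 2 / (2 * n - 1) * ∑ j ∈ Finset.range (2 * n - 1),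
      f (node n j) * Real.cos (k * node n j),
    fun k => 2 / (2 * n - 1) * ∑ j ∈ Finset.range (2 * n - 1),
      f (node n j) * Real.sin (k * node n j), fun x => ?_⟩
  have h : ∀ k : ℕ,
      (2 / (2 * n - 1) * ∑ j ∈ Finset.range (2 * n - 1),
        f (node n j) * Real.cos (k * node n j)) * Real.cos (k * x)
      + (2 / (2 * n - 1) * ∑ j ∈ Finset.range (2 * n - 1),
        f (node n j) * Real.sin (k * node n j)) * Real.sin (k * x)
      = 2 / (2 * n - 1) * ∑ j ∈ Finset.range (2 * n - 1),
        f (node n j) * Real.cos (k * (x - node n j)) := by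
    intro k
    rw [mul_assoc, mul_assoc, ← mul_add, Finset.sum_mul, Finset.sum_mul,
      ← Finset.sum_add_distrib]
    congr 1
    refine Finset.sum_congr rfl fun j _ => ?_
    rw [mul_sub, Real.cos_sub]
    ring
  simp only [h]
  simp only [interpPoly, dirichlet, Nat.cast_zero, zero_mul, Real.cos_zero, mul_one]
  rw [← Finset.mul_sum, Finset.sum_comm, mul_div_assoc, ← mul_add, Finset.sum_div,
    ← Finset.sum_add_distrib]
  congr 1
  refine Finset.sum_congr rfl fun j _ => ?_
  rw [← Finset.mul_sum]
  ring

theorem interpPoly_node (m : ℕ) (f : ℝ → ℝ) (i : ℕ) (hi : i < 2 * (m + 1) - 1) :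
    interpPoly (m + 1) f (node (m + 1) i) = f (node (m + 1) i) := by
  unfold interpPoly
  rw [Finset.sum_eq_single i]
  · rw [dirichlet_node_sub m i i hi hi, if_pos rfl]
    push_cast
    rw [show (2 * ((m : ℝ) + 1) - 1) = 2 * m + 1 by ring]
    have hN : (2 * (m : ℝ) + 1) ≠ 0 := by positivity
    field_simp
  · intro j hj hji
    rw [dirichlet_node_sub m i j hi (Finset.mem_range.mp hj), if_neg (Ne.symm hji), mul_zero]
  · intro h
    exact absurd (Finset.mem_range.mpr hi) h

theorem IsTrigPoly.periodic {m : ℕ} {T : ℝ → ℝ} (h : IsTrigPoly m T) :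
    Function.Periodic T (2 * Real.pi) := by
  obtain ⟨a, b, hT⟩ := h
  intro x
  rw [hT, hT]
  congr 1
  refine Finset.sum_congr rfl fun k _ => ?_
  rw [mul_add, Real.cos_add_nat_mul_two_pi, Real.sin_add_nat_mul_two_pi]

/-- Periodic functions agree at all nodes once they agree at the `2 n - 1` nodes of one period. -/
theorem agree_of_agree_range (m : ℕ) {f g : ℝ → ℝ} (hf : Function.Periodic f (2 * Real.pi))
    (hg : Function.Periodic g (2 * Real.pi))
    (h : ∀ i : ℕ, i < 2 * (m + 1) - 1 → f (node (m + 1) i) = g (node (m + 1) i)) (k : ℤ) :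
    f (node (m + 1) k) = g (node (m + 1) k) := by
  have hpos : (0 : ℤ) < 2 * (m : ℤ) + 1 := by positivity
  obtain ⟨i, hi⟩ := Int.eq_ofNat_of_zero_le (Int.emod_nonneg k hpos.ne')
  have hlt := Int.emod_lt_of_pos k hpos
  have hk : (k : ℝ) = i + (2 * m + 1) * ((k / (2 * (m : ℤ) + 1) : ℤ) : ℝ) := by
    have := Int.emod_add_mul_ediv k (2 * (m : ℤ) + 1)
    rw [hi] at this
    exact_mod_cast this.symm
  have hnode : node (m + 1) k
      = node (m + 1) i + ((k / (2 * (m : ℤ) + 1) : ℤ) : ℝ) * (2 * Real.pi) := by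
    have hN : (2 * (m : ℝ) + 1) ≠ 0 := by positivity
    simp only [node]
    rw [hk]
    push_cast
    rw [show (2 * ((m : ℝ) + 1) - 1) = 2 * m + 1 by ring]
    field_simp
  rw [hnode, hf.int_mul, hg.int_mul]
  exact h i (by omega)

/-- Existence and uniqueness of the interpolation polynomial. -/
theorem isTrigInterp_iff {n : ℕ} (hn : 1 ≤ n) {f : ℝ → ℝ}
    (hf : Function.Periodic f (2 * Real.pi)) (T : ℝ → ℝ) :
    IsTrigInterp n f T ↔ T = interpPoly n f := by
  obtain ⟨m, rfl⟩ : ∃ m, n = m + 1 := ⟨n - 1, by omega⟩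
  constructor
  · rintro ⟨⟨a, b, hT⟩, hval⟩
    let ev : (ℝ × (Fin m → ℝ) × (Fin m → ℝ)) →ₗ[ℝ] (ℝ → ℝ) :=
      { toFun := fun c x => c.1 / 2 + ∑ k : Fin m,
          (c.2.1 k * Real.cos (((k : ℕ) + 1 : ℕ) * x) + c.2.2 k * Real.sin (((k : ℕ) + 1 : ℕ) * x))
        map_add' := by
          intro c d
          funext x
          simp only [Prod.fst_add, Prod.snd_add, Pi.add_apply, add_mul, Finset.sum_add_distrib]
          ring
        map_smul' := by
          intro s c
          funext x
          simp only [Prod.smul_fst, Prod.smul_snd, Pi.smul_apply, smul_eq_mul, RingHom.id_apply,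
            mul_add, Finset.mul_sum, mul_assoc, Finset.sum_add_distrib]
          ring }
    let res : (ℝ → ℝ) →ₗ[ℝ] (Fin (2 * (m + 1) - 1) → ℝ) :=
      LinearMap.funLeft ℝ ℝ (fun i : Fin (2 * (m + 1) - 1) => node (m + 1) ((i : ℕ) : ℤ))
    have hrepr : ∀ a b : ℕ → ℝ, (fun x : ℝ => a 0 / 2 +
        ∑ k ∈ Finset.Icc 1 m, (a k * Real.cos (k * x) + b k * Real.sin (k * x)))
        = ev (a 0, fun k => a (k + 1), fun k => b (k + 1)) := by
      intro a b
      funext x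
      change _ = a 0 / 2 + ∑ k : Fin m, (a (k + 1) * Real.cos (((k : ℕ) + 1 : ℕ) * x)
        + b (k + 1) * Real.sin (((k : ℕ) + 1 : ℕ) * x))
      rw [Fin.sum_univ_eq_sum_range (fun k : ℕ => a (k + 1) * Real.cos ((k + 1 : ℕ) * x)
        + b (k + 1) * Real.sin ((k + 1 : ℕ) * x)) m, ← Finset.Ico_add_one_right_eq_Icc,
        Finset.sum_Ico_eq_sum_range]
      simp only [Nat.add_sub_cancel, add_comm 1]
    have hsurj : Function.Surjective (res ∘ₗ ev) := by
      intro v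
      have hinj : Function.Injective
          (fun i : Fin (2 * (m + 1) - 1) => node (m + 1) ((i : ℕ) : ℤ)) := by
        intro i j hij
        by_contra hne
        have h1 := dirichlet_node_sub m i j i.2 j.2
        have h2 := dirichlet_node_sub m i i i.2 i.2
        simp only at hij
        rw [← hij, h2, if_pos rfl, if_neg (fun h => hne (Fin.ext h))] at h1
        have : (0 : ℝ) < (2 * (m : ℝ) + 1) / 2 := by positivity
        linarith
      obtain ⟨g, hg⟩ := LinearMap.funLeft_surjective_of_injective ℝ ℝ _ hinj v
      obtain ⟨a', b', hab⟩ := isTrigPoly_interpPoly (m + 1) g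
      refine ⟨(a' 0, fun k => a' (k + 1), fun k => b' (k + 1)), ?_⟩
      rw [LinearMap.comp_apply, ← hrepr, ← hg]
      funext i
      have h3 := interpPoly_node m g i i.2
      rw [hab] at h3
      exact h3
    have hinj : Function.Injective (res ∘ₗ ev) := by
      refine (LinearMap.injective_iff_surjective_of_finrank_eq_finrank ?_).mpr hsurj
      simp only [Module.finrank_prod, Module.finrank_self, Module.finrank_fin_fun]
      omega
    obtain ⟨a', b', hab⟩ := isTrigPoly_interpPoly (m + 1) f
    have e1 : T = ev (a 0, fun k => a (k + 1), fun k => b (k + 1)) := by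
      rw [← hrepr]; exact funext hT
    have e2 : interpPoly (m + 1) f = ev (a' 0, fun k => a' (k + 1), fun k => b' (k + 1)) := by
      rw [← hrepr]; exact funext hab
    have e3 : res T = res (interpPoly (m + 1) f) := by
      funext i
      change T (node (m + 1) ((i : ℕ) : ℤ)) = interpPoly (m + 1) f (node (m + 1) ((i : ℕ) : ℤ))
      rw [hval, interpPoly_node m f i i.2]
    rw [e1, e2]
    rw [e1, e2] at e3
    rw [hinj e3]
  · rintro rfl
    have hp := isTrigPoly_interpPoly (m + 1) f
    exact ⟨hp, agree_of_agree_range m hp.periodic hf (interpPoly_node m f)⟩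

/-- Functions of the convolution classes are `2π`-periodic. -/
theorem periodic_of_mem_convClass {ψ β : ℕ → ℝ} {f : ℝ → ℝ} (hf : f ∈ convClass ψ β) :
    Function.Periodic f (2 * Real.pi) := by
  obtain ⟨a₀, φ, -, -, -, -, h⟩ := hf
  have hk : Function.Periodic (kernel ψ β) (2 * Real.pi) := by
    intro t
    unfold kernel
    refine tsum_congr fun k => ?_
    rw [show (((k + 1 : ℕ) : ℝ) * (t + 2 * Real.pi) - Real.pi * β (k + 1) / 2)
      = (((k + 1 : ℕ) : ℝ) * t - Real.pi * β (k + 1) / 2) + ((k + 1 : ℕ) : ℝ) * (2 * Real.pi)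
      by ring, Real.cos_add_nat_mul_two_pi]
  intro x
  rw [h, h]
  congr 3
  funext t
  rw [show x + 2 * Real.pi - t = (x - t) + 2 * Real.pi by ring, hk]

/-- The least upper bound over the class `F` of the `L_p`-errors of interpolation. -/
def interpError (n : ℕ) (F : Set (ℝ → ℝ)) (p : ℝ≥0∞) : ℝ≥0∞ :=
  ⨆ f ∈ F, eLpNorm (fun x => f x - interpPoly n f x) p periodMeasure

/-- The constant `2^{1 - 1/p} / π^{1 + 1/p} ‖cos‖_p²`, with `1/∞ = 0`. -/
def interpConst (p : ℝ≥0∞) : ℝ :=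
  (2 : ℝ) ^ (1 - (p⁻¹).toReal) / Real.pi ^ (1 + (p⁻¹).toReal) *
    (eLpNorm Real.cos p periodMeasure).toReal ^ 2

end TrigInterp

end

namespace TrigInterp

/-! Interpolation at `2n - 1` equidistant nodes acts on cosines by aliasing: a wave of frequency `k`
is replaced by the wave of frequency `m ≡ k (mod 2n - 1)`, `|m| ≤ n - 1`. Frequencies below `n` are
therefore reproduced. Frequency `n` aliases to `1 - n` and leaves the error `2 sin((2n-1)x/2) sin(c
- x/2)` (`cosError_self`), and every higher frequency leaves an error of modulus at most 2.

Integrated against `φ`, this gives the error of `f` as `(2/π) ψ(n) ρ sin(Nx/2) sin(θ - x/2)`, with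
`N = 2n - 1` and `|ρ| ≤ 1`, up to `(2/π) ∑_{k>n} |ψ(k)|` uniformly in `x`
(`abs_sub_interpPoly_sub_le`, `exists_integral_sin_sub_mul_eq`). Only `ρ` and `θ` depend on `φ`.

The norm of `sin(Nx/2) sin(θ - x/2)` hardly depends on `θ`. For `p < ∞` it is Lipschitz and
`π/N`-periodic in `θ`, hence within `O(1/N)` of its `p`-mean over `θ`. By Fubini that mean separates
into two sine integrals and equals `(2π)^{-1/p} ‖cos‖_p²`. For `p = ∞` a suitable point `x` shows
the same closeness to 1. This is `abs_periodNorm_profile_sub_le`, uniform in `p`.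

The upper bound follows from `|ρ| ≤ 1`. For the lower bound, densities concentrated where `cos(nt +
γ)` is near `±1` bring `ρ` arbitrarily close to 1 (`exists_density`); the resulting phase is
immaterial. For `ψ(k) = k^{-r}` an integral comparison and `(n/(n+1))^r ≤ e^{-r/(n+1)}` control the
tail. The equivalences follow because `c_p` is bounded below uniformly in `p`
(`interpConst_lower_bound`). -/

/-! ### Norms over one period -/

instance : IsFiniteMeasure periodMeasure := by
  unfold periodMeasure; infer_instance

theorem periodMeasure_univ : periodMeasure Set.univ = ENNReal.ofReal (2 * Real.pi) := by
  simp [periodMeasure]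

theorem integral_periodMeasure (g : ℝ → ℝ) :
    ∫ x, g x ∂periodMeasure = ∫ x in (0 : ℝ)..(2 * Real.pi), g x := by
  rw [intervalIntegral.integral_of_le Real.two_pi_pos.le]; rfl

theorem periodMeasure_univ_rpow_le {p : ℝ≥0∞} (hp : 1 ≤ p) :
    periodMeasure Set.univ ^ p.toReal⁻¹ ≤ ENNReal.ofReal (2 * Real.pi) := by
  rw [periodMeasure_univ]
  have h1 : (1 : ℝ) ≤ 2 * Real.pi := by nlinarith [Real.pi_gt_three]
  have h2 : p.toReal⁻¹ ≤ 1 := by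
    rcases eq_or_ne p ∞ with rfl | h
    · simp
    · exact inv_le_one_of_one_le₀ (by simpa using (ENNReal.toReal_le_toReal (by simp) h).2 hp)
  calc ENNReal.ofReal (2 * Real.pi) ^ p.toReal⁻¹
      ≤ ENNReal.ofReal (2 * Real.pi) ^ (1 : ℝ) :=
        ENNReal.rpow_le_rpow_of_exponent_le (ENNReal.one_le_ofReal.2 h1) h2
    _ = _ := by simp

/-- A pointwise bound `|f| ≤ |g| + c` costs at most `2πc` in every `L_p`-norm over a period. -/
theorem eLpNorm_le_add_of_abs_le {p : ℝ≥0∞} (hp : 1 ≤ p) {f g : ℝ → ℝ} {c : ℝ}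
    (hg : AEStronglyMeasurable g periodMeasure) (hc : 0 ≤ c)
    (h : ∀ x, |f x| ≤ |g x| + c) :
    eLpNorm f p periodMeasure ≤ eLpNorm g p periodMeasure + ENNReal.ofReal (2 * Real.pi * c) := by
  have h1 : eLpNorm f p periodMeasure
      ≤ eLpNorm ((fun x => ‖g x‖) + fun _ => c) p periodMeasure := by
    refine eLpNorm_mono fun x => ?_
    rw [Real.norm_eq_abs, Real.norm_eq_abs]
    exact (h x).trans (le_abs_self _)
  refine h1.trans ((eLpNorm_add_le hg.norm aestronglyMeasurable_const hp).trans ?_)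
  rw [eLpNorm_norm]
  gcongr
  refine (eLpNorm_le_of_ae_bound (C := c) (ae_of_all _ fun x => ?_)).trans ?_
  · simp [abs_of_nonneg hc]
  · rw [ENNReal.ofReal_mul Real.two_pi_pos.le]
    gcongr
    exact periodMeasure_univ_rpow_le hp

theorem eLpNorm_le_of_abs_le {p : ℝ≥0∞} (hp : 1 ≤ p) {f : ℝ → ℝ} {c : ℝ} (hc : 0 ≤ c)
    (h : ∀ x, |f x| ≤ c) :
    eLpNorm f p periodMeasure ≤ ENNReal.ofReal (2 * Real.pi * c) := by
  simpa using eLpNorm_le_add_of_abs_le (g := fun _ => 0) hp aestronglyMeasurable_const hc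
    (by simpa using h)

/-- The `L_p`-norm over a period as a real number. -/
noncomputable def periodNorm (p : ℝ≥0∞) (g : ℝ → ℝ) : ℝ := (eLpNorm g p periodMeasure).toReal

theorem periodNorm_nonneg (p : ℝ≥0∞) (g : ℝ → ℝ) : 0 ≤ periodNorm p g := ENNReal.toReal_nonneg

theorem periodNorm_le_of_abs_le {p : ℝ≥0∞} (hp : 1 ≤ p) {f : ℝ → ℝ} {c : ℝ} (hc : 0 ≤ c)
    (h : ∀ x, |f x| ≤ c) : periodNorm p f ≤ 2 * Real.pi * c :=
  ENNReal.toReal_le_of_le_ofReal (by positivity) (eLpNorm_le_of_abs_le hp hc h)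

theorem periodNorm_le_add_of_abs_le {p : ℝ≥0∞} (hp : 1 ≤ p) {f g : ℝ → ℝ} {c : ℝ}
    (hg : AEStronglyMeasurable g periodMeasure) (hc : 0 ≤ c)
    (hg' : eLpNorm g p periodMeasure ≠ ∞) (h : ∀ x, |f x| ≤ |g x| + c) :
    periodNorm p f ≤ periodNorm p g + 2 * Real.pi * c := by
  refine ENNReal.toReal_le_of_le_ofReal (add_nonneg (periodNorm_nonneg p g) (by positivity)) ?_
  rw [ENNReal.ofReal_add (periodNorm_nonneg p g) (by positivity), periodNorm,
    ENNReal.ofReal_toReal hg']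
  exact eLpNorm_le_add_of_abs_le hp hg hc h

theorem periodNorm_const_mul (p : ℝ≥0∞) (c : ℝ) (g : ℝ → ℝ) :
    periodNorm p (fun x => c * g x) = |c| * periodNorm p g := by
  have := eLpNorm_const_smul c g p periodMeasure
  simp only [periodNorm]
  rw [show (fun x => c * g x) = c • g from rfl, this]
  simp

theorem periodNorm_rpow {p : ℝ≥0∞} (hp : 1 ≤ p) (hp' : p ≠ ∞) {g : ℝ → ℝ}
    (hg : MemLp g p periodMeasure) :
    periodNorm p g ^ p.toReal = ∫ x in (0 : ℝ)..(2 * Real.pi), |g x| ^ p.toReal := by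
  have h0 : p ≠ 0 := (one_pos.trans_le hp).ne'
  have hpos : 0 < p.toReal := ENNReal.toReal_pos h0 hp'
  have hI : 0 ≤ ∫ x, ‖g x‖ ^ p.toReal ∂periodMeasure := integral_nonneg fun x => by positivity
  rw [periodNorm, hg.eLpNorm_eq_integral_rpow_norm h0 hp', ENNReal.toReal_ofReal (by positivity),
    ← Real.rpow_mul hI, inv_mul_cancel₀ hpos.ne', Real.rpow_one, integral_periodMeasure]
  rfl

theorem memLp_of_abs_le {p : ℝ≥0∞} {g : ℝ → ℝ} {c : ℝ} (hg : Continuous g)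
    (h : ∀ x, |g x| ≤ c) : MemLp g p periodMeasure :=
  MemLp.of_bound hg.aestronglyMeasurable c (ae_of_all _ h)

/-! ### Dependence of the profile's norm on the phase -/

/-- `sin (N x / 2) sin (θ - x / 2)`, the profile of the leading part of the interpolation error. -/
noncomputable def profile (N : ℕ) (θ x : ℝ) : ℝ := Real.sin (N * x / 2) * Real.sin (θ - x / 2)

theorem abs_profile (N : ℕ) (θ x : ℝ) :
    |profile N θ x| = |Real.sin (N * x / 2)| * |Real.sin (θ - x / 2)| := abs_mul _ _

theorem abs_profile_le_one (N : ℕ) (θ x : ℝ) : |profile N θ x| ≤ 1 := by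
  rw [abs_profile]
  exact mul_le_one₀ (Real.abs_sin_le_one _) (abs_nonneg _) (Real.abs_sin_le_one _)

theorem continuous_profile (N : ℕ) (θ : ℝ) : Continuous (profile N θ) := by
  unfold profile; fun_prop

theorem memLp_profile (p : ℝ≥0∞) (N : ℕ) (θ : ℝ) : MemLp (profile N θ) p periodMeasure :=
  memLp_of_abs_le (continuous_profile N θ) (abs_profile_le_one N θ)

theorem abs_sin_periodic : Function.Periodic (fun x => |Real.sin x|) Real.pi := fun x => by
  simp [Real.sin_add_pi]

theorem abs_profile_periodic (N : ℕ) (θ : ℝ) :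
    Function.Periodic (fun x => |profile N θ x|) (2 * Real.pi) := fun x => by
  simp only [abs_profile]
  rw [show (N : ℝ) * (x + 2 * Real.pi) / 2 = N * x / 2 + N * Real.pi by ring,
    show θ - (x + 2 * Real.pi) / 2 = θ - x / 2 - Real.pi by ring]
  congr 1
  · exact abs_sin_periodic.nat_mul N _
  · exact abs_sin_periodic.sub_eq _

theorem abs_profile_sub (N : ℕ) (θ θ' x : ℝ) :
    |profile N θ x| ≤ |profile N θ' x| + |θ - θ'| := by
  have h1 : |Real.sin (θ - x / 2)| ≤ |Real.sin (θ' - x / 2)| + |θ - θ'| := by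
    have h2 : |Real.sin (θ - x / 2) - Real.sin (θ' - x / 2)| ≤ |θ - θ'| := by
      have := Real.abs_sin_sub_sin_le (θ - x / 2) (θ' - x / 2)
      simpa using this
    have := abs_sub_abs_le_abs_sub (Real.sin (θ - x / 2)) (Real.sin (θ' - x / 2))
    linarith
  rw [abs_profile, abs_profile]
  have h3 := Real.abs_sin_le_one (N * x / 2)
  have h4 := abs_nonneg (Real.sin (N * x / 2))
  nlinarith [abs_nonneg (θ - θ')]

theorem periodNorm_profile_le_add {p : ℝ≥0∞} (hp : 1 ≤ p) (N : ℕ) (θ θ' : ℝ) :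
    periodNorm p (profile N θ) ≤ periodNorm p (profile N θ') + 2 * Real.pi * |θ - θ'| :=
  periodNorm_le_add_of_abs_le hp (continuous_profile N θ').aestronglyMeasurable (abs_nonneg _)
    (memLp_profile p N θ').eLpNorm_ne_top (abs_profile_sub N θ θ')

theorem continuous_periodNorm_profile {p : ℝ≥0∞} (hp : 1 ≤ p) (N : ℕ) :
    Continuous fun θ => periodNorm p (profile N θ) := by
  refine (LipschitzWith.of_le_add_mul (⟨2 * Real.pi, Real.two_pi_pos.le⟩) fun θ θ' => ?_).continuous
  rw [Real.dist_eq]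
  exact periodNorm_profile_le_add hp N θ θ'

/-- Since `|sin(Nx/2)|` has period `2π/N`, a translation of `x` by this amount is felt only by the
second factor, as a phase shift. This is the source of the short period in `θ`. -/
theorem abs_profile_add (N : ℕ) (hN : N ≠ 0) (θ x : ℝ) :
    |profile N (θ + Real.pi / N) x| = |profile N θ (x - 2 * Real.pi / N)| := by
  have hN' : (N : ℝ) ≠ 0 := by exact_mod_cast hN
  rw [abs_profile, abs_profile]
  congr 1
  · rw [show (N : ℝ) * (x - 2 * Real.pi / N) / 2 = N * x / 2 - Real.pi by field_simp]
    exact (abs_sin_periodic.sub_eq _).symm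
  · congr 2; ring

theorem periodNorm_profile_periodic {p : ℝ≥0∞} (hp : 1 ≤ p) (hp' : p ≠ ∞) (N : ℕ) (hN : N ≠ 0) :
    Function.Periodic (fun θ => periodNorm p (profile N θ)) (Real.pi / N) := by
  intro θ
  have hq : 0 < p.toReal := ENNReal.toReal_pos (one_pos.trans_le hp).ne' hp'
  refine (Real.rpow_left_inj (periodNorm_nonneg _ _) (periodNorm_nonneg _ _) hq.ne').1 ?_
  rw [periodNorm_rpow hp hp' (memLp_profile p N _), periodNorm_rpow hp hp' (memLp_profile p N _)]
  simp only [abs_profile_add N hN]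
  rw [intervalIntegral.integral_comp_sub_right (fun x => |profile N θ x| ^ p.toReal)]
  have hper : Function.Periodic (fun x => |profile N θ x| ^ p.toReal) (2 * Real.pi) :=
    (abs_profile_periodic N θ).comp (· ^ p.toReal)
  have := hper.intervalIntegral_add_eq (0 - 2 * Real.pi / N) 0
  rw [zero_add] at this
  rw [← this]
  congr 1
  ring

/-! ### The mean over the phase -/

/-- `∫_0^π |sin|^q`. -/
noncomputable def sinPowIntegral (q : ℝ) : ℝ := ∫ x in (0 : ℝ)..Real.pi, |Real.sin x| ^ q

theorem continuous_abs_sin_rpow {q : ℝ} (hq : 0 < q) : Continuous fun x => |Real.sin x| ^ q :=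
  Real.continuous_sin.abs.rpow_const fun _ => Or.inr hq.le

theorem abs_sin_rpow_periodic (q : ℝ) :
    Function.Periodic (fun x => |Real.sin x| ^ q) Real.pi :=
  abs_sin_periodic.comp (· ^ q)

theorem integral_abs_sin_rpow_period (q t : ℝ) :
    ∫ x in t..t + Real.pi, |Real.sin x| ^ q = sinPowIntegral q := by
  have := (abs_sin_rpow_periodic q).intervalIntegral_add_eq t 0
  rwa [zero_add] at this

theorem integral_abs_sin_rpow_nat_mul {q : ℝ} (hq : 0 < q) (m : ℕ) (t : ℝ) :
    ∫ x in t..t + m * Real.pi, |Real.sin x| ^ q = m * sinPowIntegral q := by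
  have := (abs_sin_rpow_periodic q).intervalIntegral_add_zsmul_eq m t
    fun a b => (continuous_abs_sin_rpow hq).intervalIntegrable a b
  simpa [integral_abs_sin_rpow_period] using this

theorem integral_abs_sin_nat_mul_half_rpow {q : ℝ} (hq : 0 < q) (N : ℕ) (hN : N ≠ 0) :
    ∫ x in (0 : ℝ)..(2 * Real.pi), |Real.sin (N * x / 2)| ^ q = 2 * sinPowIntegral q := by
  have hN' : (N : ℝ) ≠ 0 := by exact_mod_cast hN
  have h1 := intervalIntegral.integral_comp_mul_left (fun x => |Real.sin x| ^ q)
    (a := 0) (b := 2 * Real.pi) (c := (N : ℝ) / 2) (by positivity)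
  have h2 := integral_abs_sin_rpow_nat_mul hq N 0
  rw [zero_add] at h2
  rw [mul_zero, show (N : ℝ) / 2 * (2 * Real.pi) = N * Real.pi by ring, h2] at h1
  simp only [mul_div_right_comm]
  rw [h1, smul_eq_mul]
  field_simp

/-- The value is independent of `y`, which is what makes the double integral over `θ` and `x`
factor. -/
theorem integral_abs_sin_sub_rpow (q y : ℝ) :
    ∫ θ in (0 : ℝ)..Real.pi, |Real.sin (θ - y)| ^ q = sinPowIntegral q := by
  rw [intervalIntegral.integral_comp_sub_right (fun x => |Real.sin x| ^ q) y,
    show Real.pi - y = (0 - y) + Real.pi by ring, integral_abs_sin_rpow_period]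

theorem periodNorm_cos_rpow {p : ℝ≥0∞} (hp : 1 ≤ p) (hp' : p ≠ ∞) :
    periodNorm p Real.cos ^ p.toReal = 2 * sinPowIntegral p.toReal := by
  have hq : 0 < p.toReal := ENNReal.toReal_pos (one_pos.trans_le hp).ne' hp'
  rw [periodNorm_rpow hp hp' (memLp_of_abs_le Real.continuous_cos Real.abs_cos_le_one)]
  simp only [← Real.sin_add_pi_div_two]
  rw [intervalIntegral.integral_comp_add_right (fun x => |Real.sin x| ^ p.toReal)]
  have := integral_abs_sin_rpow_nat_mul hq 2 (0 + Real.pi / 2)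
  rw [show 2 * Real.pi + Real.pi / 2 = 0 + Real.pi / 2 + (2 : ℕ) * Real.pi by push_cast; ring, this]
  norm_num

/-- The mean over `θ` of the `p`-th power of the norm of the profile. -/
theorem integral_periodNorm_profile_rpow {p : ℝ≥0∞} (hp : 1 ≤ p) (hp' : p ≠ ∞) (N : ℕ)
    (hN : N ≠ 0) :
    ∫ θ in (0 : ℝ)..Real.pi, periodNorm p (profile N θ) ^ p.toReal
      = 2 * sinPowIntegral p.toReal ^ 2 := by
  have hq : 0 < p.toReal := ENNReal.toReal_pos (one_pos.trans_le hp).ne' hp'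
  have hcont : Continuous (Function.uncurry fun θ x => |profile N θ x| ^ p.toReal) := by
    refine Continuous.rpow_const ?_ fun _ => Or.inr hq.le
    unfold profile
    fun_prop
  have hint : Integrable (Function.uncurry fun θ x => |profile N θ x| ^ p.toReal)
      ((volume.restrict (Set.uIoc 0 Real.pi)).prod periodMeasure) := by
    rw [Set.uIoc_of_le Real.pi_pos.le]
    refine Integrable.of_bound hcont.aestronglyMeasurable 1 (ae_of_all _ fun z => ?_)
    rw [Real.norm_eq_abs, Function.uncurry, abs_of_nonneg (by positivity)]
    exact Real.rpow_le_one (abs_nonneg _) (abs_profile_le_one _ _ _) hq.le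
  simp only [periodNorm_rpow hp hp' (memLp_profile p N _), ← integral_periodMeasure]
  rw [intervalIntegral_integral_swap hint]
  simp only [abs_profile, Real.mul_rpow (abs_nonneg _) (abs_nonneg _),
    intervalIntegral.integral_const_mul, integral_abs_sin_sub_rpow]
  rw [integral_mul_const, integral_periodMeasure, integral_abs_sin_nat_mul_half_rpow hq N hN]
  ring

/-- `(2π)^{-1/p} ‖cos‖_p²`, the limit of the norms of the profiles. -/
noncomputable def profileLimit (p : ℝ≥0∞) : ℝ :=
  (2 * Real.pi) ^ (-(p⁻¹).toReal) * periodNorm p Real.cos ^ 2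

theorem profileLimit_nonneg (p : ℝ≥0∞) : 0 ≤ profileLimit p := by
  unfold profileLimit; positivity

theorem interpConst_eq (p : ℝ≥0∞) : interpConst p = 2 / Real.pi * profileLimit p := by
  have hpi := Real.pi_pos
  rw [interpConst, profileLimit, periodNorm, Real.rpow_sub two_pos, Real.rpow_add hpi,
    Real.mul_rpow two_pos.le hpi.le, Real.rpow_neg two_pos.le, Real.rpow_neg hpi.le,
    Real.rpow_one, Real.rpow_one]
  field_simp

/-- Identifies the limit constant with the `p`-mean computed in `integral_periodNorm_profile_rpow`:
the `p`-th power of `‖cos‖_p` is twice the sine integral. -/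
theorem profileLimit_rpow {p : ℝ≥0∞} (hp : 1 ≤ p) (hp' : p ≠ ∞) :
    Real.pi * profileLimit p ^ p.toReal = 2 * sinPowIntegral p.toReal ^ 2 := by
  have hq : 0 < p.toReal := ENNReal.toReal_pos (one_pos.trans_le hp).ne' hp'
  have h2 : (periodNorm p Real.cos ^ 2) ^ p.toReal = (2 * sinPowIntegral p.toReal) ^ 2 := by
    rw [← periodNorm_cos_rpow hp hp', ← Real.rpow_natCast, ← Real.rpow_natCast,
      ← Real.rpow_mul (periodNorm_nonneg _ _), ← Real.rpow_mul (periodNorm_nonneg _ _), mul_comm]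
  rw [profileLimit, Real.mul_rpow (by positivity) (by positivity), h2,
    ← Real.rpow_mul Real.two_pi_pos.le, ENNReal.toReal_inv, neg_mul, inv_mul_cancel₀ hq.ne',
    Real.rpow_neg_one]
  have := Real.pi_pos
  field_simp

/-! ### Profile norms are within `O(1/N)` of the limit -/

theorem exists_int_mul_near {d : ℝ} (hd : 0 < d) (x : ℝ) : ∃ k : ℤ, |x - k * d| ≤ d := by
  refine ⟨⌊x / d⌋, ?_⟩
  have h1 := Int.floor_le (x / d)
  have h2 := Int.lt_floor_add_one (x / d)
  rw [le_div_iff₀ hd] at h1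
  rw [div_lt_iff₀ hd] at h2
  rw [abs_of_nonneg (by linarith)]
  linarith

/-- Modulo the period `π/N` any two phases are at distance at most `π/N`, and the norm is Lipschitz
in the phase with constant `2π`. -/
theorem periodNorm_profile_oscillation {p : ℝ≥0∞} (hp : 1 ≤ p) (hp' : p ≠ ∞) (N : ℕ) (hN : N ≠ 0)
    (θ θ' : ℝ) :
    periodNorm p (profile N θ) ≤ periodNorm p (profile N θ') + 2 * Real.pi * (Real.pi / N) := by
  have hd : 0 < Real.pi / N := by positivity
  obtain ⟨k, hk⟩ := exists_int_mul_near hd (θ - θ')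
  have h1 := (periodNorm_profile_periodic hp hp' N hN).int_mul k θ'
  have h2 := periodNorm_profile_le_add hp N θ (θ' + k * (Real.pi / N))
  rw [h1, ← sub_sub] at h2
  refine h2.trans ?_
  gcongr

/-- A nonnegative function stays within its oscillation of its own power mean, whatever the
exponent; hence the bound does not depend on `p`. -/
theorem abs_periodNorm_profile_sub_le_of_ne_top {p : ℝ≥0∞} (hp : 1 ≤ p) (hp' : p ≠ ∞) (N : ℕ)
    (hN : N ≠ 0) (θ : ℝ) :
    |periodNorm p (profile N θ) - profileLimit p| ≤ 2 * Real.pi * (Real.pi / N) := by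
  have hq : 0 < p.toReal := ENNReal.toReal_pos (one_pos.trans_le hp).ne' hp'
  set h := fun θ => periodNorm p (profile N θ) with hh
  have hcont : Continuous fun θ => h θ ^ p.toReal :=
    (continuous_periodNorm_profile hp N).rpow_const fun _ => Or.inr hq.le
  have havg : ∫ θ in (0 : ℝ)..Real.pi, h θ ^ p.toReal = Real.pi * profileLimit p ^ p.toReal := by
    rw [profileLimit_rpow hp hp', hh, integral_periodNorm_profile_rpow hp hp' N hN]
  have hconst : ∀ c : ℝ, ∫ _ in (0 : ℝ)..Real.pi, c = Real.pi * c := fun c => by simp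
  have hosc := periodNorm_profile_oscillation hp hp' N hN
  rw [abs_le]
  constructor
  · have h1 : Real.pi * profileLimit p ^ p.toReal
        ≤ Real.pi * (h θ + 2 * Real.pi * (Real.pi / N)) ^ p.toReal := by
      rw [← havg, ← hconst]
      refine intervalIntegral.integral_mono_on Real.pi_pos.le (hcont.intervalIntegrable _ _)
        (continuous_const.intervalIntegrable _ _) fun t _ => ?_
      exact Real.rpow_le_rpow (periodNorm_nonneg _ _) (hosc t θ) hq.le
    have h2 := (Real.rpow_le_rpow_iff (profileLimit_nonneg p)
      (add_nonneg (periodNorm_nonneg _ _) (by positivity)) hq).1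
      (le_of_mul_le_mul_left h1 Real.pi_pos)
    linarith
  -- The negated claim makes the base `h θ - 2π·π/N` nonnegative, as monotonicity of the power
  -- requires.
  · by_contra! hcon
    have hpos : 0 ≤ h θ - 2 * Real.pi * (Real.pi / N) := by
      have := profileLimit_nonneg p
      linarith
    have h1 : Real.pi * (h θ - 2 * Real.pi * (Real.pi / N)) ^ p.toReal
        ≤ Real.pi * profileLimit p ^ p.toReal := by
      rw [← havg, ← hconst]
      refine intervalIntegral.integral_mono_on Real.pi_pos.le
        (continuous_const.intervalIntegrable _ _) (hcont.intervalIntegrable _ _) fun t _ => ?_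
      exact Real.rpow_le_rpow hpos (by have := hosc θ t; simp only [hh]; linarith) hq.le
    have h2 := (Real.rpow_le_rpow_iff hpos (profileLimit_nonneg p) hq).1
      (le_of_mul_le_mul_left h1 Real.pi_pos)
    linarith

/-- A continuous function with periodic modulus is bounded by its `L_∞`-norm everywhere. -/
theorem abs_le_periodNorm_top {g : ℝ → ℝ} (hg : Continuous g)
    (hper : Function.Periodic (fun x => |g x|) (2 * Real.pi))
    (hfin : eLpNorm g ∞ periodMeasure ≠ ∞) (x : ℝ) : |g x| ≤ periodNorm ∞ g := by
  have hae : ∀ᵐ y ∂periodMeasure, |g y| ≤ periodNorm ∞ g := by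
    rw [eLpNorm_exponent_top] at hfin
    filter_upwards [enorm_ae_le_eLpNormEssSup g periodMeasure] with y hy
    have := ENNReal.toReal_mono hfin hy
    simpa [periodNorm] using this
  -- By continuity, one violation inside the interval would produce an open set of violations, of
  -- positive measure. Closure then adds the endpoints and periodicity the other points.
  have hIoo : ∀ y ∈ Set.Ioo 0 (2 * Real.pi), |g y| ≤ periodNorm ∞ g := by
    by_contra! hcon
    obtain ⟨y, hy, hlt⟩ := hcon
    have hopen : IsOpen ({z | periodNorm ∞ g < |g z|} ∩ Set.Ioo 0 (2 * Real.pi)) :=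
      (isOpen_lt continuous_const hg.abs).inter isOpen_Ioo
    refine (hopen.measure_pos volume ⟨y, hlt, hy⟩).ne' ?_
    rw [ae_iff, periodMeasure, Measure.restrict_apply' measurableSet_Ioc] at hae
    refine measure_mono_null ?_ hae
    rintro z ⟨hz, hz'⟩
    exact ⟨not_le.2 hz, Set.Ioo_subset_Ioc_self hz'⟩
  have hIcc : ∀ y ∈ Set.Icc 0 (2 * Real.pi), |g y| ≤ periodNorm ∞ g := by
    rw [← closure_Ioo Real.two_pi_pos.ne]
    exact fun y hy => closure_minimal hIoo (isClosed_le hg.abs continuous_const) hy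
  obtain ⟨y, hy, hxy⟩ := hper.exists_mem_Ico₀ Real.two_pi_pos x
  rw [hxy]
  exact hIcc y (Set.Ico_subset_Icc_self hy)

theorem profileLimit_top : profileLimit ∞ = 1 := by
  have h : periodNorm ∞ Real.cos = 1 := by
    refine le_antisymm ?_ ?_
    · refine ENNReal.toReal_le_of_le_ofReal zero_le_one ?_
      refine (eLpNorm_le_of_ae_bound (ae_of_all _ fun x => Real.abs_cos_le_one x)).trans ?_
      simp
    · have hper : Function.Periodic (fun x => |Real.cos x|) (2 * Real.pi) :=
        Real.cos_periodic.comp abs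
      simpa using abs_le_periodNorm_top Real.continuous_cos hper
        (memLp_of_abs_le Real.continuous_cos Real.abs_cos_le_one).eLpNorm_ne_top 0
  simp [profileLimit, h]

theorem abs_periodNorm_profile_sub_le {p : ℝ≥0∞} (hp : 1 ≤ p) (N : ℕ) (hN : N ≠ 0) (θ : ℝ) :
    |periodNorm p (profile N θ) - profileLimit p| ≤ 2 * Real.pi * (Real.pi / N) := by
  rcases ne_or_eq p ∞ with hp' | rfl
  · exact abs_periodNorm_profile_sub_le_of_ne_top hp hp' N hN θ
  have hN' : (N : ℝ) ≠ 0 := by exact_mod_cast hN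
  have hd : 0 < Real.pi / N := by positivity
  have hup : periodNorm ∞ (profile N θ) ≤ 1 := by
    refine ENNReal.toReal_le_of_le_ofReal zero_le_one ?_
    refine (eLpNorm_le_of_ae_bound (ae_of_all _ (abs_profile_le_one N θ))).trans ?_
    simp
  -- Among the points `x` where `|sin(Nx/2)| = 1`, spaced by `2π/N`, one is chosen for which the
  -- phase `π/2 + x/2`, making the other factor 1 as well, lies within `π/N` of `θ`.
  obtain ⟨k, hk⟩ := exists_int_mul_near hd (Real.pi / 2 + Real.pi / (2 * N) - θ)
  set x : ℝ := Real.pi / N - 2 * k * Real.pi / N with hx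
  have h1 := abs_le_periodNorm_top (continuous_profile N θ) (abs_profile_periodic N θ)
    (memLp_profile ∞ N θ).eLpNorm_ne_top x
  have h2 := abs_profile_sub N (Real.pi / 2 + x / 2) θ x
  have h3 : |profile N (Real.pi / 2 + x / 2) x| = 1 := by
    rw [abs_profile, show (N : ℝ) * x / 2 = Real.pi / 2 - k * Real.pi by rw [hx]; field_simp,
      add_sub_cancel_right]
    have := abs_sin_periodic.sub_int_mul_eq k (x := Real.pi / 2)
    rw [this]
    simp
  have h4 : Real.pi / 2 + x / 2 - θ
      = Real.pi / 2 + Real.pi / (2 * N) - θ - k * (Real.pi / N) := by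
    rw [hx]; field_simp; ring
  rw [h3, h4] at h2
  rw [profileLimit_top, abs_of_nonpos (by linarith)]
  have h5 : 1 ≤ 2 * Real.pi := by nlinarith [Real.pi_gt_three]
  nlinarith

/-! ### Aliasing and the interpolation error of a single frequency -/

theorem isTrigPoly_cos_sub {M : ℕ} {m : ℤ} (hm : m.natAbs ≤ M) (c : ℝ) :
    IsTrigPoly M fun x => Real.cos (m * x - c) := by
  obtain ⟨s, hs⟩ : ∃ s : ℝ, ∀ x, Real.cos (m * x - c)
      = Real.cos c * Real.cos (m.natAbs * x) + s * Real.sin (m.natAbs * x) := by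
    rcases Int.natAbs_eq m with h | h
    · refine ⟨Real.sin c, fun x => ?_⟩
      have h' : (m : ℝ) = (m.natAbs : ℝ) :=
        (congrArg (Int.cast : ℤ → ℝ) h).trans (Int.cast_natCast _)
      rw [h', Real.cos_sub]; ring
    · refine ⟨-Real.sin c, fun x => ?_⟩
      have h' : (m : ℝ) = -(m.natAbs : ℝ) := by
        have := congrArg (Int.cast : ℤ → ℝ) h
        rwa [Int.cast_neg, Int.cast_natCast] at this
      rw [h', neg_mul, Real.cos_sub, Real.cos_neg, Real.sin_neg]; ring
  rcases Nat.eq_zero_or_pos m.natAbs with h0 | h0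
  -- The factor 2 compensates the convention `a 0 / 2` for the constant term.
  · refine ⟨fun k => if k = 0 then 2 * Real.cos c else 0, fun _ => 0, fun x => ?_⟩
    refine (hs x).trans ?_
    rw [Finset.sum_eq_zero]
    · simp [h0]
    · intro k hk
      have := (Finset.mem_Icc.1 hk).1
      simp [show k ≠ 0 by omega]
  · refine ⟨fun k => if k = m.natAbs then Real.cos c else 0,
      fun k => if k = m.natAbs then s else 0, fun x => ?_⟩
    refine (hs x).trans ?_
    rw [Finset.sum_eq_single m.natAbs]
    · simp [show 0 ≠ m.natAbs by omega]
    · intro k _ hk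
      simp [hk]
    · intro h
      exact absurd (Finset.mem_Icc.2 ⟨h0, hm⟩) h

/-- Aliasing: frequencies that agree modulo `2 n - 1` have the same interpolation polynomial. -/
theorem interpPoly_cos_sub {n : ℕ} (hn : 1 ≤ n) (k m q : ℤ) (hm : m.natAbs ≤ n - 1)
    (hk : k = m + q * (2 * n - 1)) (c : ℝ) :
    interpPoly n (fun x => Real.cos (k * x - c)) = fun x => Real.cos (m * x - c) := by
  have hper : Function.Periodic (fun x => Real.cos (k * x - c)) (2 * Real.pi) := fun x => by
    simp only
    rw [show (k : ℝ) * (x + 2 * Real.pi) - c = (k * x - c) + k * (2 * Real.pi) by ring,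
      Real.cos_add_int_mul_two_pi]
  refine ((isTrigInterp_iff hn hper _).1 ⟨isTrigPoly_cos_sub hm c, fun j => ?_⟩).symm
  have hN : (2 * (n : ℝ) - 1) ≠ 0 := by
    have : (1 : ℝ) ≤ n := by exact_mod_cast hn
    linarith
  have h1 : (k : ℝ) * node n j - c = (m * node n j - c) + ((q * j : ℤ) : ℝ) * (2 * Real.pi) := by
    have : (k : ℝ) = m + q * (2 * n - 1) := by exact_mod_cast hk
    rw [this, node]
    push_cast
    field_simp
    ring
  simp only
  rw [h1, Real.cos_add_int_mul_two_pi]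

theorem interpPoly_const_mul (n : ℕ) (a : ℝ) (g : ℝ → ℝ) (x : ℝ) :
    interpPoly n (fun u => a * g u) x = a * interpPoly n g x := by
  simp only [interpPoly, mul_assoc, ← Finset.mul_sum]
  ring

theorem interpPoly_const {n : ℕ} (hn : 1 ≤ n) (a x : ℝ) : interpPoly n (fun _ => a) x = a := by
  have h := congrFun (interpPoly_cos_sub hn 0 0 0 (by simp) (by simp) 0) x
  simp only [Int.cast_zero, zero_mul, sub_zero, Real.cos_zero] at h
  have h2 := interpPoly_const_mul n a (fun _ => 1) x
  rwa [h, mul_one] at h2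

/-- The interpolation error of `cos (k x - c)`. -/
noncomputable def cosError (n k : ℕ) (c x : ℝ) : ℝ :=
  Real.cos (k * x - c) - interpPoly n (fun u => Real.cos (k * u - c)) x

theorem cosError_eq {n : ℕ} (hn : 1 ≤ n) (k : ℕ) (m q : ℤ) (hm : m.natAbs ≤ n - 1)
    (hk : (k : ℤ) = m + q * (2 * n - 1)) (c x : ℝ) :
    cosError n k c x = Real.cos (k * x - c) - Real.cos (m * x - c) := by
  have := congrFun (interpPoly_cos_sub hn k m q hm hk c) x
  simp only [Int.cast_natCast] at this
  rw [cosError, this]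

/-- Every frequency has an alias in `[-(n-1), n-1]`, so the error is a difference of two cosines. -/
theorem abs_cosError_le {n : ℕ} (hn : 1 ≤ n) (k : ℕ) (c x : ℝ) : |cosError n k c x| ≤ 2 := by
  have hN : (0 : ℤ) < 2 * n - 1 := by omega
  -- The shift by `n - 1` turns the residue in `[0, 2n-2]` into the balanced one.
  have h1 := Int.emod_nonneg ((k : ℤ) + n - 1) hN.ne'
  have h2 := Int.emod_lt_of_pos ((k : ℤ) + n - 1) hN
  have h3 := Int.emod_add_mul_ediv ((k : ℤ) + n - 1) (2 * n - 1)
  rw [cosError_eq hn k (((k : ℤ) + n - 1) % (2 * n - 1) - (n - 1))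
    (((k : ℤ) + n - 1) / (2 * n - 1)) (by omega) (by linarith)]
  refine (abs_sub _ _).trans ?_
  linarith [Real.abs_cos_le_one (k * x - c), Real.abs_cos_le_one
    ((((k : ℤ) + n - 1) % (2 * n - 1) - (n - 1) : ℤ) * x - c)]

theorem cosError_of_lt {n : ℕ} {k : ℕ} (hk : k < n) (c x : ℝ) : cosError n k c x = 0 := by
  rw [cosError_eq (by omega) k k 0 (by omega) (by simp)]
  simp

/-- The alias comes from `n = (1 - n) + (2n - 1)`; sum-to-product then yields the profile, with `c`
as its phase. -/
theorem cosError_self {n : ℕ} (hn : 1 ≤ n) (c x : ℝ) :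
    cosError n n c x
      = 2 * (Real.sin ((2 * n - 1 : ℕ) * x / 2) * Real.sin (c - x / 2)) := by
  rw [cosError_eq hn n (1 - n) 1 (by omega) (by ring), Real.cos_sub_cos]
  push_cast [show 1 ≤ 2 * n by omega]
  rw [show ((n : ℝ) * x - c + ((1 - n) * x - c)) / 2 = -(c - x / 2) by ring,
    show ((n : ℝ) * x - c - ((1 - n) * x - c)) / 2 = (2 * n - 1) * x / 2 by ring, Real.sin_neg]
  ring

/-! ### The error of a convolution as an integral against the kernel error -/

theorem summable_kernel_term {ψ : ℕ → ℝ} (hψ : Summable fun k => |ψ (k + 1)|) (β : ℕ → ℝ) (t : ℝ) :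
    Summable fun k : ℕ =>
      ψ (k + 1) * Real.cos (((k + 1 : ℕ) : ℝ) * t - Real.pi * β (k + 1) / 2) := by
  refine Summable.of_norm_bounded hψ fun k => ?_
  rw [Real.norm_eq_abs, abs_mul]
  exact mul_le_of_le_one_right (abs_nonneg _) (Real.abs_cos_le_one _)

theorem continuous_kernel {ψ : ℕ → ℝ} (hψ : Summable fun k => |ψ (k + 1)|) (β : ℕ → ℝ) :
    Continuous (kernel ψ β) := by
  refine continuous_tsum (fun k => by fun_prop) hψ fun k t => ?_
  rw [Real.norm_eq_abs, abs_mul]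
  exact mul_le_of_le_one_right (abs_nonneg _) (Real.abs_cos_le_one _)

/-- The interpolation error of the translated kernel. -/
noncomputable def kernelError (ψ β : ℕ → ℝ) (n : ℕ) (x t : ℝ) : ℝ :=
  kernel ψ β (x - t) - interpPoly n (fun u => kernel ψ β (u - t)) x

theorem hasSum_interpPoly {F : ℕ → ℝ → ℝ} {g : ℝ → ℝ} (h : ∀ u, HasSum (fun k => F k u) (g u))
    (n : ℕ) (x : ℝ) : HasSum (fun k => interpPoly n (F k) x) (interpPoly n g x) := by
  unfold interpPoly
  exact (hasSum_sum fun j _ => (h _).mul_right _).mul_left _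

theorem hasSum_kernelError {ψ : ℕ → ℝ} (hψ : Summable fun k => |ψ (k + 1)|) (β : ℕ → ℝ) (n : ℕ)
    (x t : ℝ) :
    HasSum (fun k : ℕ => ψ (k + 1) *
      cosError n (k + 1) ((k + 1 : ℕ) * t + Real.pi * β (k + 1) / 2) x)
      (kernelError ψ β n x t) := by
  have h1 : ∀ u : ℝ, HasSum (fun k : ℕ => ψ (k + 1) *
      Real.cos ((k + 1 : ℕ) * u - ((k + 1 : ℕ) * t + Real.pi * β (k + 1) / 2)))
      (kernel ψ β (u - t)) := fun u => by
    have e : HasSum _ (kernel ψ β (u - t)) := (summable_kernel_term hψ β (u - t)).hasSum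
    convert e using 1
    funext k
    rw [mul_sub, sub_sub]
  have h2 := (h1 x).sub (hasSum_interpPoly h1 n x)
  simp only [interpPoly_const_mul, ← mul_sub] at h2
  exact h2

/-- Frequencies below `n` are interpolated exactly, and each one above `n` costs at most twice its
coefficient. -/
theorem abs_kernelError_sub_le {ψ : ℕ → ℝ} (hψ : Summable fun k => |ψ (k + 1)|) (β : ℕ → ℝ)
    {n : ℕ} (hn : 1 ≤ n) (x t : ℝ) :
    |kernelError ψ β n x t - ψ n * cosError n n (n * t + Real.pi * β n / 2) x|
      ≤ 2 * ∑' k : ℕ, |ψ (k + n + 1)| := by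
  set F : ℕ → ℝ := fun k => ψ (k + 1) *
      cosError n (k + 1) ((k + 1 : ℕ) * t + Real.pi * β (k + 1) / 2) x with hF
  have hsum : HasSum F (kernelError ψ β n x t) := hasSum_kernelError hψ β n x t
  -- Index `k` carries frequency `k + 1`, so these are the frequencies `1, …, n`, of which only the
  -- last survives.
  have hfin : ∑ k ∈ Finset.range n, F k = ψ n * cosError n n (n * t + Real.pi * β n / 2) x := by
    obtain ⟨m, rfl⟩ : ∃ m, n = m + 1 := ⟨n - 1, by omega⟩
    rw [Finset.sum_range_succ, Finset.sum_eq_zero, zero_add]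
    intro k hk
    simp only [hF]
    rw [cosError_of_lt (by have := Finset.mem_range.1 hk; omega), mul_zero]
  have hsplit := hsum.summable.sum_add_tsum_nat_add n
  rw [hsum.tsum_eq, hfin] at hsplit
  rw [← hsplit, add_sub_cancel_left, ← Real.norm_eq_abs]
  have hs : Summable fun k : ℕ => |ψ (k + n + 1)| := (summable_nat_add_iff n).2 hψ
  refine tsum_of_norm_bounded (hs.hasSum.mul_left 2) fun k => ?_
  rw [Real.norm_eq_abs, hF, abs_mul, mul_comm]
  gcongr
  exact abs_cosError_le hn _ _ _

theorem continuous_kernelError {ψ : ℕ → ℝ} (hψ : Summable fun k => |ψ (k + 1)|) (β : ℕ → ℝ)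
    (n : ℕ) (x : ℝ) : Continuous (kernelError ψ β n x) := by
  have := continuous_kernel hψ β
  unfold kernelError interpPoly
  fun_prop

/-- Interpolation is a finite linear combination of point values, so it passes under the integral
sign; the constant `a₀ / 2` is reproduced and cancels. -/
theorem sub_interpPoly_eq {ψ : ℕ → ℝ} (hψ : Summable fun k => |ψ (k + 1)|) (β : ℕ → ℝ)
    {n : ℕ} (hn : 1 ≤ n) {φ : ℝ → ℝ} (hφ : IntervalIntegrable φ volume 0 (2 * Real.pi)) {a₀ : ℝ}
    {f : ℝ → ℝ} (hf : ∀ x, f x = a₀ / 2 +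
        (1 / Real.pi) * ∫ t in (0 : ℝ)..(2 * Real.pi), kernel ψ β (x - t) * φ t) (x : ℝ) :
    f x - interpPoly n f x
      = (1 / Real.pi) * ∫ t in (0 : ℝ)..(2 * Real.pi), kernelError ψ β n x t * φ t := by
  have hint : ∀ u, IntervalIntegrable (fun t => kernel ψ β (u - t) * φ t) volume 0 (2 * Real.pi) :=
    fun u => hφ.continuousOn_mul
      ((continuous_kernel hψ β).comp (continuous_const.sub continuous_id)).continuousOn
  have hint' : ∀ j : ℕ, IntervalIntegrable (fun t => kernel ψ β (node n j - t) * φ t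
      * dirichlet n (x - node n j)) volume 0 (2 * Real.pi) := fun j => (hint _).mul_const _
  have hI : interpPoly n f x = a₀ / 2 + (1 / Real.pi) * (2 / (2 * n - 1) *
      ∑ j ∈ Finset.range (2 * n - 1), (∫ t in (0 : ℝ)..(2 * Real.pi),
        kernel ψ β (node n j - t) * φ t) * dirichlet n (x - node n j)) := by
    conv_rhs => rw [← interpPoly_const hn (a₀ / 2) x]
    simp only [interpPoly, hf, add_mul, Finset.sum_add_distrib, mul_add, mul_assoc,
      ← Finset.mul_sum]
    ring
  have hK : ∀ t, kernelError ψ β n x t * φ t = kernel ψ β (x - t) * φ t - 2 / (2 * n - 1) *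
      ∑ j ∈ Finset.range (2 * n - 1), kernel ψ β (node n j - t) * φ t
        * dirichlet n (x - node n j) := fun t => by
    rw [kernelError, interpPoly, sub_mul, mul_assoc, Finset.sum_mul]
    congr 2
    exact Finset.sum_congr rfl fun j _ => by ring
  have hsumint : IntervalIntegrable (fun t => ∑ j ∈ Finset.range (2 * n - 1),
      kernel ψ β (node n j - t) * φ t * dirichlet n (x - node n j)) volume 0 (2 * Real.pi) := by
    simpa only [Finset.sum_fn] using
      IntervalIntegrable.sum (Finset.range (2 * n - 1)) fun j _ => hint' j
  rw [hI, hf]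
  simp only [hK]
  rw [intervalIntegral.integral_sub (hint x) (hsumint.const_mul _),
    intervalIntegral.integral_const_mul, intervalIntegral.integral_finsetSum fun j _ => hint' j]
  simp only [intervalIntegral.integral_mul_const]
  ring

/-! ### Pairing with densities: leading term, amplitude and phase -/

theorem intervalIntegrable_of_memLp_one {φ : ℝ → ℝ} (hφ : MemLp φ 1 periodMeasure) :
    IntervalIntegrable φ volume 0 (2 * Real.pi) :=
  (intervalIntegrable_iff_integrableOn_Ioc_of_le Real.two_pi_pos.le).2 (memLp_one_iff_integrable.1 hφ)

theorem integral_abs_eq_toReal_eLpNorm_one {φ : ℝ → ℝ} (hφ : MemLp φ 1 periodMeasure) :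
    ∫ t in (0 : ℝ)..(2 * Real.pi), |φ t| = periodNorm 1 φ := by
  have := periodNorm_rpow le_rfl ENNReal.one_ne_top hφ
  simpa using this.symm

theorem integral_abs_le_one {φ : ℝ → ℝ} (hφ : MemLp φ 1 periodMeasure)
    (h1 : eLpNorm φ 1 periodMeasure ≤ 1) : ∫ t in (0 : ℝ)..(2 * Real.pi), |φ t| ≤ 1 := by
  rw [integral_abs_eq_toReal_eLpNorm_one hφ]
  exact ENNReal.toReal_le_of_le_ofReal zero_le_one (by simpa using h1)

theorem abs_integral_mul_le {φ g : ℝ → ℝ} (hφ : MemLp φ 1 periodMeasure)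
    (h1 : eLpNorm φ 1 periodMeasure ≤ 1) {B : ℝ} (hB : 0 ≤ B) (hg : ∀ t, |g t| ≤ B) :
    |∫ t in (0 : ℝ)..(2 * Real.pi), g t * φ t| ≤ B := by
  have h2 := intervalIntegral.norm_integral_le_of_norm_le Real.two_pi_pos.le
    (f := fun t => g t * φ t) (g := fun t => B * |φ t|) (μ := volume)
    (ae_of_all _ fun t _ => by
      rw [Real.norm_eq_abs, abs_mul]
      exact mul_le_mul_of_nonneg_right (hg t) (abs_nonneg _))
    ((intervalIntegrable_of_memLp_one hφ).abs.const_mul B)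
  rw [intervalIntegral.integral_const_mul] at h2
  exact h2.trans (mul_le_of_le_one_right hB (integral_abs_le_one hφ h1))

/-- The interpolation error up to the contribution of the frequencies above `n`. -/
theorem abs_sub_interpPoly_sub_le {ψ : ℕ → ℝ} (hψ : Summable fun k => |ψ (k + 1)|) (β : ℕ → ℝ)
    {n : ℕ} (hn : 1 ≤ n) {φ : ℝ → ℝ} (hφ : MemLp φ 1 periodMeasure)
    (h1 : eLpNorm φ 1 periodMeasure ≤ 1) {a₀ : ℝ}
    {f : ℝ → ℝ} (hf : ∀ x, f x = a₀ / 2 +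
        (1 / Real.pi) * ∫ t in (0 : ℝ)..(2 * Real.pi), kernel ψ β (x - t) * φ t) (x : ℝ) :
    |f x - interpPoly n f x - 2 / Real.pi * ψ n * (Real.sin ((2 * n - 1 : ℕ) * x / 2) *
        ∫ t in (0 : ℝ)..(2 * Real.pi), Real.sin (n * t + Real.pi * β n / 2 - x / 2) * φ t)|
      ≤ 2 / Real.pi * ∑' k : ℕ, |ψ (k + n + 1)| := by
  have hI := intervalIntegrable_of_memLp_one hφ
  have hτ : 0 ≤ ∑' k : ℕ, |ψ (k + n + 1)| := tsum_nonneg fun k => abs_nonneg _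
  have hpi := Real.pi_pos
  have hmain : 2 / Real.pi * ψ n * (Real.sin ((2 * n - 1 : ℕ) * x / 2) *
        ∫ t in (0 : ℝ)..(2 * Real.pi), Real.sin (n * t + Real.pi * β n / 2 - x / 2) * φ t)
      = (1 / Real.pi) * ∫ t in (0 : ℝ)..(2 * Real.pi),
        ψ n * cosError n n (n * t + Real.pi * β n / 2) x * φ t := by
    simp only [cosError_self hn]
    rw [show (fun t => ψ n * (2 * (Real.sin ((2 * n - 1 : ℕ) * x / 2) *
        Real.sin (n * t + Real.pi * β n / 2 - x / 2))) * φ t)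
      = fun t => (2 * ψ n * Real.sin ((2 * n - 1 : ℕ) * x / 2)) *
        (Real.sin (n * t + Real.pi * β n / 2 - x / 2) * φ t) by ext t; ring,
      intervalIntegral.integral_const_mul]
    ring
  have hc1 : IntervalIntegrable (fun t => kernelError ψ β n x t * φ t) volume 0 (2 * Real.pi) :=
    hI.continuousOn_mul (continuous_kernelError hψ β n x).continuousOn
  have hc2 : IntervalIntegrable (fun t => ψ n * cosError n n (n * t + Real.pi * β n / 2) x * φ t)
      volume 0 (2 * Real.pi) := by
    refine hI.continuousOn_mul (Continuous.continuousOn ?_)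
    simp only [cosError_self hn]
    fun_prop
  rw [sub_interpPoly_eq hψ β hn hI hf, hmain, ← mul_sub, ← intervalIntegral.integral_sub hc1 hc2,
    abs_mul, abs_of_pos (by positivity)]
  simp only [← sub_mul]
  have := abs_integral_mul_le hφ h1 (by positivity) (abs_kernelError_sub_le hψ β hn x)
  calc 1 / Real.pi * _ ≤ 1 / Real.pi * (2 * ∑' k : ℕ, |ψ (k + n + 1)|) := by gcongr
    _ = _ := by ring

/-- The amplitude and phase of the integral against a function of the unit ball of `L_1`. -/
theorem exists_integral_sin_sub_mul_eq {φ : ℝ → ℝ} (hφ : MemLp φ 1 periodMeasure)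
    (h1 : eLpNorm φ 1 periodMeasure ≤ 1) (n : ℕ) (γ : ℝ) :
    ∃ ρ θ : ℝ, |ρ| ≤ 1 ∧ ∀ y, ∫ t in (0 : ℝ)..(2 * Real.pi), Real.sin (n * t + γ - y) * φ t
      = ρ * Real.sin (θ - y) := by
  have hI := intervalIntegrable_of_memLp_one hφ
  set A := ∫ t in (0 : ℝ)..(2 * Real.pi), Real.sin (n * t + γ) * φ t with hA
  set B := ∫ t in (0 : ℝ)..(2 * Real.pi), Real.cos (n * t + γ) * φ t with hB
  have hAi : IntervalIntegrable (fun t => Real.sin (n * t + γ) * φ t) volume 0 (2 * Real.pi) :=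
    hI.continuousOn_mul (by fun_prop)
  have hBi : IntervalIntegrable (fun t => Real.cos (n * t + γ) * φ t) volume 0 (2 * Real.pi) :=
    hI.continuousOn_mul (by fun_prop)
  have hexp : ∀ y, ∫ t in (0 : ℝ)..(2 * Real.pi), Real.sin (n * t + γ - y) * φ t
      = A * Real.cos y - B * Real.sin y := fun y => by
    rw [hA, hB, ← intervalIntegral.integral_mul_const, ← intervalIntegral.integral_mul_const,
      ← intervalIntegral.integral_sub (hAi.mul_const _) (hBi.mul_const _)]
    congr 1
    ext t
    rw [Real.sin_sub]
    ring
  -- Amplitude and phase are the modulus and argument of `B + iA`.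
  set z : ℂ := ⟨B, A⟩
  have hz1 : ‖z‖ * Real.cos z.arg = B := Complex.norm_mul_cos_arg z
  have hz2 : ‖z‖ * Real.sin z.arg = A := Complex.norm_mul_sin_arg z
  have hform : ∀ y, ∫ t in (0 : ℝ)..(2 * Real.pi), Real.sin (n * t + γ - y) * φ t
      = ‖z‖ * Real.sin (z.arg - y) := fun y => by
    rw [hexp, Real.sin_sub, ← hz1, ← hz2]
    ring
  refine ⟨‖z‖, z.arg, ?_, hform⟩
  -- At this `y` the sine on the right is 1, so the amplitude is itself an integral of a sine
  -- against `φ`, hence at most 1.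
  have h2 := hform (z.arg - Real.pi / 2)
  rw [sub_sub_cancel, Real.sin_pi_div_two, mul_one] at h2
  rw [← h2]
  exact abs_integral_mul_le hφ h1 zero_le_one fun t => Real.abs_sin_le_one _

theorem integral_comp_nat_mul_add {F : ℝ → ℝ} (hF : Continuous F)
    (hper : Function.Periodic F (2 * Real.pi)) {n : ℕ} (hn : 1 ≤ n) (γ : ℝ) :
    ∫ t in (0 : ℝ)..(2 * Real.pi), F (n * t + γ) = ∫ t in (0 : ℝ)..(2 * Real.pi), F t := by
  have hn' : (n : ℝ) ≠ 0 := by positivity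
  rw [intervalIntegral.integral_comp_mul_add F hn' γ]
  have h1 := hper.intervalIntegral_add_zsmul_eq n (n * 0 + γ)
    fun a b => hF.intervalIntegrable a b
  have h2 := hper.intervalIntegral_add_eq (n * 0 + γ) 0
  rw [zero_add] at h2
  rw [h2] at h1
  rw [show (n : ℝ) * (2 * Real.pi) + γ = n * 0 + γ + (n : ℤ) • (2 * Real.pi) by simp [add_comm], h1]
  simp [hn']

/-! ### Near-extremal densities -/

/-- The odd function that vanishes on `[-(1 - ε), 1 - ε]` and has slope one elsewhere. -/
noncomputable def softThreshold (ε v : ℝ) : ℝ := max (v - (1 - ε)) 0 - max (-v - (1 - ε)) 0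

theorem softThreshold_neg (ε v : ℝ) : softThreshold ε (-v) = -softThreshold ε v := by
  simp [softThreshold]

/-- Where the threshold function is nonzero it has the sign of `v` and `|v| ≥ 1 - ε`. With `v = cos
t`, integration makes the normalised first cosine coefficient at least `1 - ε`. -/
theorem le_mul_softThreshold {ε : ℝ} (hε : ε < 1) (v : ℝ) :
    (1 - ε) * |softThreshold ε v| ≤ v * softThreshold ε v := by
  unfold softThreshold
  rcases le_total v (1 - ε) with h1 | h1
  · rcases le_total (-v) (1 - ε) with h2 | h2
    · rw [max_eq_right (by linarith), max_eq_right (by linarith)]; simp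
    · rw [max_eq_right (by linarith), max_eq_left (by linarith), abs_of_nonpos (by linarith)]
      nlinarith
  · rw [max_eq_left (by linarith), max_eq_right (by linarith), abs_of_nonneg (by linarith)]
    nlinarith

/-- Densities of the unit ball of `L_1` orthogonal to constants whose `n`-th Fourier coefficient has
a prescribed phase and an amplitude as close to one as desired. -/
theorem exists_density {n : ℕ} (hn : 1 ≤ n) (γ : ℝ) {ε : ℝ} (hε : 0 < ε) (hε1 : ε < 1) :
    ∃ (φ : ℝ → ℝ) (ρ : ℝ), Function.Periodic φ (2 * Real.pi) ∧ MemLp φ 1 periodMeasure ∧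
      eLpNorm φ 1 periodMeasure ≤ 1 ∧ ∫ t in (0 : ℝ)..(2 * Real.pi), φ t = 0 ∧ 1 - ε ≤ ρ ∧
      ∀ y, ∫ t in (0 : ℝ)..(2 * Real.pi), Real.sin (n * t + γ - y) * φ t
        = ρ * Real.sin (0 - y) := by
  set G : ℝ → ℝ := fun u => softThreshold ε (Real.cos u) with hG
  have hGc : Continuous G := by
    simp only [hG, softThreshold]
    fun_prop
  have hGper : Function.Periodic G (2 * Real.pi) :=
    Real.cos_periodic.comp (softThreshold ε)
  set L := ∫ t in (0 : ℝ)..(2 * Real.pi), |G t| with hL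
  have hLpos : 0 < L := by
    refine intervalIntegral.integral_pos Real.two_pi_pos hGc.abs.continuousOn
      (fun x _ => abs_nonneg _) ⟨0, ⟨le_rfl, Real.two_pi_pos.le⟩, abs_pos.2 ?_⟩
    simp only [hG, softThreshold, Real.cos_zero]
    rw [max_eq_left (by linarith), max_eq_right (by linarith)]
    linarith
  -- `G` changes sign under `t ↦ t + π`.
  have hG0 : ∫ t in (0 : ℝ)..(2 * Real.pi), G t = 0 := by
    have h1 : ∫ t in (0 : ℝ)..(2 * Real.pi), G (t + Real.pi) = -∫ t in (0 : ℝ)..(2 * Real.pi), G t := by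
      rw [← intervalIntegral.integral_neg]
      simp only [hG, Real.cos_add_pi, softThreshold_neg]
    rw [intervalIntegral.integral_comp_add_right] at h1
    have h2 := hGper.intervalIntegral_add_eq (0 + Real.pi) 0
    rw [show 0 + Real.pi + 2 * Real.pi = 2 * Real.pi + Real.pi by ring, zero_add (2 * Real.pi)] at h2
    linarith
  -- The integrand is odd under `t ↦ 2π - t`; this forces the phase 0.
  have hGs : ∫ t in (0 : ℝ)..(2 * Real.pi), Real.sin t * G t = 0 := by
    have h1 := intervalIntegral.integral_comp_sub_left (fun t => Real.sin t * G t) (2 * Real.pi)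
      (a := 0) (b := 2 * Real.pi)
    simp only [hG, Real.sin_two_pi_sub, Real.cos_two_pi_sub, sub_self, sub_zero, neg_mul,
      intervalIntegral.integral_neg] at h1
    simp only [hG]
    linarith
  set ρ := (∫ t in (0 : ℝ)..(2 * Real.pi), Real.cos t * G t) / L with hρ
  have hφc : Continuous fun t => L⁻¹ * G (n * t + γ) := by fun_prop
  have hLp : MemLp (fun t => L⁻¹ * G (n * t + γ)) 1 periodMeasure := by
    refine memLp_one_iff_integrable.2 ?_
    exact (intervalIntegrable_iff_integrableOn_Ioc_of_le Real.two_pi_pos.le).1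
      (hφc.intervalIntegrable _ _)
  refine ⟨fun t => L⁻¹ * G (n * t + γ), ρ, fun t => ?_, hLp, ?_, ?_, ?_, fun y => ?_⟩
  · simp only
    rw [show (n : ℝ) * (t + 2 * Real.pi) + γ = n * t + γ + n * (2 * Real.pi) by ring,
      hGper.nat_mul n]
  · have h1 := integral_abs_eq_toReal_eLpNorm_one hLp
    simp only [abs_mul, abs_of_pos (inv_pos.2 hLpos), intervalIntegral.integral_const_mul] at h1
    rw [integral_comp_nat_mul_add hGc.abs (hGper.comp abs) hn γ, ← hL,
      inv_mul_cancel₀ hLpos.ne'] at h1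
    rw [← ENNReal.ofReal_toReal hLp.eLpNorm_ne_top]
    simp [periodNorm] at h1
    simp [← h1]
  · rw [intervalIntegral.integral_const_mul, integral_comp_nat_mul_add hGc hGper hn γ, hG0,
      mul_zero]
  · rw [hρ, le_div_iff₀ hLpos, hL, ← intervalIntegral.integral_const_mul]
    refine intervalIntegral.integral_mono_on Real.two_pi_pos.le
      (Continuous.intervalIntegrable (by fun_prop) _ _)
      (Continuous.intervalIntegrable (by fun_prop) _ _) fun t _ => ?_
    exact le_mul_softThreshold hε1 _
  · have h1 := integral_comp_nat_mul_add (F := fun u => Real.sin (u - y) * (L⁻¹ * G u))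
      (by fun_prop) (fun u => by
        simp only
        rw [hGper, show u + 2 * Real.pi - y = u - y + 2 * Real.pi by ring, Real.sin_add_two_pi])
      hn γ
    rw [h1, show (fun u => Real.sin (u - y) * (L⁻¹ * G u)) = fun u =>
      (L⁻¹ * Real.cos y) * (Real.sin u * G u) - (L⁻¹ * Real.sin y) * (Real.cos u * G u) by
        ext u; rw [Real.sin_sub]; ring,
      intervalIntegral.integral_sub (Continuous.intervalIntegrable (by fun_prop) _ _)
        (Continuous.intervalIntegrable (by fun_prop) _ _),
      intervalIntegral.integral_const_mul, intervalIntegral.integral_const_mul, hGs, hρ, zero_sub,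
      Real.sin_neg]
    ring

/-! ### Two-sided bounds for a summable coefficient sequence -/

theorem interpError_le {ψ : ℕ → ℝ} (hψ : Summable fun k => |ψ (k + 1)|) (β : ℕ → ℝ)
    {n : ℕ} (hn : 1 ≤ n) {p : ℝ≥0∞} (hp : 1 ≤ p) :
    interpError n (convClass ψ β) p ≤ ENNReal.ofReal (2 / Real.pi * |ψ n| *
      (profileLimit p + 2 * Real.pi * (Real.pi / (2 * n - 1 : ℕ)))
      + 2 * Real.pi * (2 / Real.pi * ∑' k : ℕ, |ψ (k + n + 1)|)) := by
  have hpi := Real.pi_pos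
  have hτ : 0 ≤ ∑' k : ℕ, |ψ (k + n + 1)| := tsum_nonneg fun k => abs_nonneg _
  refine iSup₂_le fun f hf => ?_
  obtain ⟨a₀, φ, -, hφ, h1, -, hf⟩ := hf
  obtain ⟨ρ, θ, hρ, hθ⟩ := exists_integral_sin_sub_mul_eq hφ h1 n (Real.pi * β n / 2)
  set c := 2 / Real.pi * ψ n * ρ with hc
  have hb : ∀ x, |f x - interpPoly n f x|
      ≤ |c * profile (2 * n - 1) θ x| + 2 / Real.pi * ∑' k : ℕ, |ψ (k + n + 1)| := fun x => by
    have h2 := abs_sub_interpPoly_sub_le hψ β hn hφ h1 hf x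
    rw [hθ, show 2 / Real.pi * ψ n * (Real.sin ((2 * n - 1 : ℕ) * x / 2) *
      (ρ * Real.sin (θ - x / 2))) = c * profile (2 * n - 1) θ x by rw [hc, profile]; ring] at h2
    linarith [abs_sub_abs_le_abs_sub (f x - interpPoly n f x) (c * profile (2 * n - 1) θ x)]
  have hmem : MemLp (fun x => c * profile (2 * n - 1) θ x) p periodMeasure :=
    (memLp_profile p _ θ).const_mul c
  refine (eLpNorm_le_add_of_abs_le hp hmem.1 (by positivity) hb).trans ?_
  rw [← ENNReal.ofReal_toReal hmem.eLpNorm_ne_top,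
    ← ENNReal.ofReal_add ENNReal.toReal_nonneg (by positivity)]
  refine ENNReal.ofReal_le_ofReal (add_le_add_left ?_ _)
  change periodNorm p _ ≤ _
  rw [periodNorm_const_mul]
  have h3 := abs_periodNorm_profile_sub_le hp (2 * n - 1) (by omega) θ
  refine mul_le_mul ?_ (by linarith [le_abs_self (periodNorm p (profile (2 * n - 1) θ)
    - profileLimit p)]) (periodNorm_nonneg _ _) (by positivity)
  rw [hc, abs_mul, abs_mul, abs_of_pos (by positivity : 0 < 2 / Real.pi)]
  exact mul_le_of_le_one_right (by positivity) hρ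

/-- A single function, built from a near-extremal density, suffices: its profile has phase 0, but
every phase gives nearly the same norm. -/
theorem le_interpError {ψ : ℕ → ℝ} (hψ : Summable fun k => |ψ (k + 1)|) (β : ℕ → ℝ)
    {n : ℕ} (hn : 1 ≤ n) {p : ℝ≥0∞} (hp : 1 ≤ p) {ε : ℝ} (hε : 0 < ε) (hε1 : ε < 1) :
    2 / Real.pi * |ψ n| *
      (profileLimit p - 2 * Real.pi * (Real.pi / (2 * n - 1 : ℕ)) - 2 * Real.pi * ε)
      - 2 * Real.pi * (2 / Real.pi * ∑' k : ℕ, |ψ (k + n + 1)|)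
      ≤ (interpError n (convClass ψ β) p).toReal := by
  have hpi := Real.pi_pos
  have hτ : 0 ≤ ∑' k : ℕ, |ψ (k + n + 1)| := tsum_nonneg fun k => abs_nonneg _
  obtain ⟨φ, ρ, hper, hφ, h1, h0, hρ, hθ⟩ := exists_density hn (Real.pi * β n / 2) hε hε1
  set f : ℝ → ℝ := fun x => (0 : ℝ) / 2 +
    (1 / Real.pi) * ∫ t in (0 : ℝ)..(2 * Real.pi), kernel ψ β (x - t) * φ t with hf
  have hfmem : f ∈ convClass ψ β := ⟨0, φ, hper, hφ, h1, h0, fun x => rfl⟩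
  set c := 2 / Real.pi * ψ n * ρ with hc
  set σ := 2 / Real.pi * ∑' k : ℕ, |ψ (k + n + 1)| with hσ
  have hσ0 : 0 ≤ σ := by positivity
  have hb : ∀ x, |c * profile (2 * n - 1) 0 x| - σ ≤ |f x - interpPoly n f x| := fun x => by
    have h2 := abs_sub_interpPoly_sub_le hψ β hn hφ h1 (a₀ := 0) (f := f) (fun x => rfl) x
    rw [hθ, show 2 / Real.pi * ψ n * (Real.sin ((2 * n - 1 : ℕ) * x / 2) *
      (ρ * Real.sin (0 - x / 2))) = c * profile (2 * n - 1) 0 x by rw [hc, profile]; ring,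
      abs_sub_comm] at h2
    linarith [abs_sub_abs_le_abs_sub (c * profile (2 * n - 1) 0 x) (f x - interpPoly n f x)]
  -- A continuous minorant of the error's modulus: the triangle inequality is applied to it, so
  -- measurability of the error itself is not needed.
  set m : ℝ → ℝ := fun x => max (|c * profile (2 * n - 1) 0 x| - σ) 0 with hm
  have hmc : Continuous m := by
    have := continuous_profile (2 * n - 1) 0
    fun_prop
  have hle : eLpNorm m p periodMeasure ≤ interpError n (convClass ψ β) p := by
    refine le_trans (eLpNorm_mono fun x => ?_) (le_iSup₂_of_le f hfmem le_rfl)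
    rw [Real.norm_eq_abs, Real.norm_eq_abs, abs_of_nonneg (le_max_right _ _)]
    exact max_le (hb x) (abs_nonneg _)
  have hfin : interpError n (convClass ψ β) p ≠ ∞ :=
    ne_top_of_le_ne_top ENNReal.ofReal_ne_top (interpError_le hψ β hn hp)
  have h3 : periodNorm p m ≤ (interpError n (convClass ψ β) p).toReal :=
    ENNReal.toReal_mono hfin hle
  have h4 : periodNorm p (fun x => c * profile (2 * n - 1) 0 x)
      ≤ periodNorm p m + 2 * Real.pi * σ := by
    refine periodNorm_le_add_of_abs_le hp hmc.aestronglyMeasurable hσ0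
      (ne_top_of_le_ne_top hfin hle) fun x => ?_
    rw [abs_of_nonneg (le_max_right _ _ : 0 ≤ m x)]
    linarith [le_max_left (|c * profile (2 * n - 1) 0 x| - σ) 0]
  rw [periodNorm_const_mul, hc, abs_mul, abs_mul, abs_of_pos (by positivity : 0 < 2 / Real.pi),
    abs_of_nonneg (by linarith : 0 ≤ ρ), mul_assoc (2 / Real.pi * |ψ n|)] at h4
  have h5 := (abs_le.1 (abs_periodNorm_profile_sub_le hp (2 * n - 1) (by omega) 0)).1
  have h6 : periodNorm p (profile (2 * n - 1) 0) ≤ 2 * Real.pi * 1 :=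
    periodNorm_le_of_abs_le hp zero_le_one (abs_profile_le_one _ _)
  -- Replacing `ρ` by 1 costs at most `ε` times the profile's norm, which is at most `2π`.
  have h7 : profileLimit p - 2 * Real.pi * (Real.pi / (2 * n - 1 : ℕ)) - 2 * Real.pi * ε
      ≤ ρ * periodNorm p (profile (2 * n - 1) 0) := by
    have := periodNorm_nonneg p (profile (2 * n - 1) 0)
    nlinarith
  have h8 := mul_le_mul_of_nonneg_left h7 (by positivity : 0 ≤ 2 / Real.pi * |ψ n|)
  linarith

/-! ### Power coefficients: the tail and the explicit estimates -/

theorem summable_abs_rpow_neg {r : ℝ} (hr : 1 < r) :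
    Summable fun k : ℕ => |((k + 1 : ℕ) : ℝ) ^ (-r)| :=
  ((summable_nat_add_iff 1).2 (Real.summable_nat_rpow.2 (by linarith : -r < -1))).abs

/-- The first term is kept, and the rest is dominated by `∫_{n+1}^∞ x^{-r} dx = (n+1)^{1-r}/(r-1)`.
-/
theorem tsum_rpow_neg_tail_le {r : ℝ} (hr : 1 < r) (n : ℕ) :
    ∑' k : ℕ, |((k + n + 1 : ℕ) : ℝ) ^ (-r)|
      ≤ ((n : ℝ) + 1) ^ (-r) * (1 + ((n : ℝ) + 1) / (r - 1)) := by
  have ha : (0 : ℝ) < (n : ℝ) + 1 := by positivity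
  have hr1 : 0 < r - 1 := by linarith
  refine Summable.tsum_le_of_sum_range_le ((summable_nat_add_iff n).2 (summable_abs_rpow_neg hr))
    fun m => ?_
  -- With one extra term, splitting off the first leaves exactly `m` terms to compare with an
  -- integral over length `m`.
  have hmono : ∑ i ∈ Finset.range m, |((i + n + 1 : ℕ) : ℝ) ^ (-r)|
      ≤ ∑ i ∈ Finset.range (m + 1), |((i + n + 1 : ℕ) : ℝ) ^ (-r)| :=
    Finset.sum_le_sum_of_subset_of_nonneg (Finset.range_mono (Nat.le_succ m))
      fun _ _ _ => abs_nonneg _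
  refine hmono.trans ?_
  have hanti : AntitoneOn (fun x : ℝ => x ^ (-r)) (Set.Icc ((n : ℝ) + 1) ((n : ℝ) + 1 + m)) :=
    fun x hx y _ hxy => Real.rpow_le_rpow_of_nonpos (ha.trans_le hx.1) hxy (by linarith)
  have hint := hanti.sum_le_integral
  rw [integral_rpow (Or.inr ⟨by linarith, by
    rw [Set.uIcc_of_le (by simp)]
    exact fun h => absurd h.1 (not_le.2 ha)⟩)] at hint
  have hval : (((n : ℝ) + 1 + m) ^ (-r + 1) - ((n : ℝ) + 1) ^ (-r + 1)) / (-r + 1)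
      ≤ ((n : ℝ) + 1) ^ (-r) * (((n : ℝ) + 1) / (r - 1)) := by
    have h1 : ((n : ℝ) + 1) ^ (-r + 1) = ((n : ℝ) + 1) ^ (-r) * ((n : ℝ) + 1) := by
      rw [Real.rpow_add ha, Real.rpow_one]
    rw [show -r + 1 = -(r - 1) by ring, div_neg, ← neg_div, neg_sub, mul_div_assoc']
    rw [← h1, show -r + 1 = -(r - 1) by ring]
    gcongr
    have := Real.rpow_nonneg (by positivity : 0 ≤ (n : ℝ) + 1 + m) (-(r - 1))
    linarith
  rw [Finset.sum_range_succ']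
  have h2 : ∀ i : ℕ, |((i + 1 + n + 1 : ℕ) : ℝ) ^ (-r)| = ((n : ℝ) + 1 + (i + 1 : ℕ)) ^ (-r) :=
    fun i => by
      rw [abs_of_nonneg (by positivity)]
      push_cast
      ring_nf
  have h3 : |((0 + n + 1 : ℕ) : ℝ) ^ (-r)| = ((n : ℝ) + 1) ^ (-r) := by
    rw [abs_of_nonneg (by positivity)]
    push_cast
    ring_nf
  simp only [h2]
  rw [h3]
  linarith

/-- The `r`-th power of `n/(n+1) = 1 - 1/(n+1) ≤ e^{-1/(n+1)}`. -/
theorem add_one_rpow_neg_le {r : ℝ} (hr : 0 ≤ r) {n : ℕ} (hn : 1 ≤ n) :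
    ((n : ℝ) + 1) ^ (-r) ≤ (n : ℝ) ^ (-r) * Real.exp (-r / ((n : ℝ) + 1)) := by
  have hn' : (0 : ℝ) < n := by exact_mod_cast hn
  have h1 : (n : ℝ) / (n + 1) ≤ Real.exp (-1 / ((n : ℝ) + 1)) := by
    have := Real.add_one_le_exp (-1 / ((n : ℝ) + 1))
    refine le_trans (le_of_eq ?_) this
    field_simp
    ring
  have h2 := Real.rpow_le_rpow (by positivity) h1 hr
  rw [← Real.exp_mul, Real.div_rpow hn'.le (by positivity),
    show -1 / ((n : ℝ) + 1) * r = -r / ((n : ℝ) + 1) by ring] at h2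
  rw [Real.rpow_neg (by positivity), Real.rpow_neg hn'.le]
  rw [inv_mul_eq_div, le_div_iff₀ (by positivity), inv_mul_eq_div]
  exact h2

/-- The constant 20: the profile error contributes `4π/(2n-1) ≤ 16/n`, the lower bound loses a
further `4/(n+1) ≤ 4/n`, and the tail enters as `4τ`, with factor at most 8. -/
theorem interpError_weylNagy {p : ℝ≥0∞} {r : ℝ} (β : ℕ → ℝ) {n : ℕ} (hp : 1 ≤ p) (hr : 1 < r)
    (hn : 1 ≤ n) :
    interpError n (weylNagyClass r β) p ≠ ∞ ∧
      |(interpError n (weylNagyClass r β) p).toReal - (n : ℝ) ^ (-r) * interpConst p|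
        ≤ (n : ℝ) ^ (-r) * (20 * (1 / (n : ℝ) +
          Real.exp (-r / ((n : ℝ) + 1)) * (1 + (n : ℝ) / (r - 1)))) := by
  have hpi := Real.pi_pos
  have hn' : (1 : ℝ) ≤ n := by exact_mod_cast hn
  have hr1 : 0 < r - 1 := by linarith
  have hψ := summable_abs_rpow_neg hr
  have hup := interpError_le (ψ := fun k => (k : ℝ) ^ (-r)) hψ β hn hp
  -- `1/(n+1)` instead of `1/n`, so that `ε < 1` also for `n = 1`.
  have hlow := le_interpError (ψ := fun k => (k : ℝ) ^ (-r)) hψ β hn hp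
    (ε := 1 / ((n : ℝ) + 1)) (by positivity) (by rw [div_lt_one (by positivity)]; linarith)
  have hfin : interpError n (weylNagyClass r β) p ≠ ∞ :=
    ne_top_of_le_ne_top ENNReal.ofReal_ne_top hup
  refine ⟨hfin, ?_⟩
  change interpError n (weylNagyClass r β) p ≤ _ at hup
  change _ ≤ (interpError n (weylNagyClass r β) p).toReal at hlow
  set w := (n : ℝ) ^ (-r) with hw
  have hw0 : 0 ≤ w := by positivity
  set e := Real.exp (-r / ((n : ℝ) + 1)) with he
  have he0 : 0 < e := Real.exp_pos _
  set τ := ∑' k : ℕ, |((k + n + 1 : ℕ) : ℝ) ^ (-r)| with hτ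
  have hτ0 : 0 ≤ τ := tsum_nonneg fun k => abs_nonneg _
  have hτle : τ ≤ w * (2 * (e * (1 + n / (r - 1)))) := by
    have h1 : 1 + ((n : ℝ) + 1) / (r - 1) ≤ 2 * (1 + n / (r - 1)) := by
      have : ((n : ℝ) + 1) / (r - 1) ≤ (2 * n) / (r - 1) := by gcongr; linarith
      rw [mul_div_assoc] at this
      linarith
    calc τ ≤ ((n : ℝ) + 1) ^ (-r) * (1 + ((n : ℝ) + 1) / (r - 1)) := tsum_rpow_neg_tail_le hr n
      _ ≤ (w * e) * (2 * (1 + n / (r - 1))) :=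
          mul_le_mul (add_one_rpow_neg_le (by linarith) hn) h1 (by positivity) (by positivity)
      _ = _ := by ring
  have hM := profileLimit_nonneg p
  rw [abs_of_nonneg hw0] at hup hlow
  have hup' := ENNReal.toReal_le_of_le_ofReal (by positivity) hup
  have hN : Real.pi / (2 * n - 1 : ℕ) ≤ 4 * (1 / (n : ℝ)) := by
    rw [mul_one_div]
    refine div_le_div₀ (by norm_num) Real.pi_le_four (by positivity) ?_
    exact_mod_cast (by omega : n ≤ 2 * n - 1)
  have hε : 1 / ((n : ℝ) + 1) ≤ 1 / n := one_div_le_one_div_of_le (by positivity) (by linarith)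
  rw [interpConst_eq]
  have e1 : 2 / Real.pi * w * (profileLimit p + 2 * Real.pi * (Real.pi / (2 * n - 1 : ℕ)))
      + 2 * Real.pi * (2 / Real.pi * τ) = w * (2 / Real.pi * profileLimit p)
        + (w * (4 * (Real.pi / (2 * n - 1 : ℕ))) + 4 * τ) := by
    generalize Real.pi / (2 * n - 1 : ℕ) = z
    field_simp
    ring
  have e2 : 2 / Real.pi * w * (profileLimit p - 2 * Real.pi * (Real.pi / (2 * n - 1 : ℕ))
        - 2 * Real.pi * (1 / ((n : ℝ) + 1)))
      - 2 * Real.pi * (2 / Real.pi * τ) = w * (2 / Real.pi * profileLimit p)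
        - (w * (4 * (Real.pi / (2 * n - 1 : ℕ)) + 4 * (1 / ((n : ℝ) + 1))) + 4 * τ) := by
    generalize Real.pi / (2 * n - 1 : ℕ) = z
    field_simp
    ring
  rw [e1] at hup'
  rw [e2] at hlow
  have hw1 : w * (4 * (Real.pi / (2 * n - 1 : ℕ)) + 4 * (1 / ((n : ℝ) + 1)))
      ≤ w * (20 * (1 / (n : ℝ))) := by gcongr; linarith
  have hw2 : w * (4 * (Real.pi / (2 * n - 1 : ℕ))) ≤ w * (20 * (1 / (n : ℝ))) := by
    refine mul_le_mul_of_nonneg_left ?_ hw0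
    have : 0 ≤ 1 / (n : ℝ) := by positivity
    linarith
  have hw3 : 4 * τ ≤ w * (20 * (e * (1 + n / (r - 1)))) := by
    have : 0 ≤ w * (e * (1 + n / (r - 1))) := by positivity
    linarith
  rw [mul_add 20, mul_add w, abs_le]
  constructor <;> linarith

/-- Here `n/(r-1) ≤ 1`, so the factor `1 + n/(r-1)` is absorbed by doubling the constant. -/
theorem interpError_weylNagy_of_le {p : ℝ≥0∞} {r : ℝ} (β : ℕ → ℝ) {n : ℕ} (hp : 1 ≤ p)
    (hn : 1 ≤ n) (hr : (n : ℝ) + 1 ≤ r) :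
    |(interpError n (weylNagyClass r β) p).toReal - (n : ℝ) ^ (-r) * interpConst p|
      ≤ (n : ℝ) ^ (-r) * (40 * (1 / (n : ℝ) + Real.exp (-r / ((n : ℝ) + 1)))) := by
  have hn' : (1 : ℝ) ≤ n := by exact_mod_cast hn
  refine (interpError_weylNagy β hp (by linarith) hn).2.trans ?_
  gcongr ?_ * ?_
  have h1 : (n : ℝ) / (r - 1) ≤ 1 := by rw [div_le_one (by linarith)]; linarith
  have h2 : 0 ≤ 1 / (n : ℝ) := by positivity
  nlinarith [Real.exp_pos (-r / ((n : ℝ) + 1))]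

/-! ### The constant `c_p` and the asymptotic equalities -/

theorem periodNorm_one_cos : periodNorm 1 Real.cos = 4 := by
  have h := periodNorm_cos_rpow le_rfl ENNReal.one_ne_top
  have h1 : sinPowIntegral 1 = 2 := by
    rw [sinPowIntegral, show (2 : ℝ) = ∫ x in (0 : ℝ)..Real.pi, Real.sin x by
      rw [integral_sin]; norm_num]
    refine intervalIntegral.integral_congr fun x hx => ?_
    rw [Set.uIcc_of_le Real.pi_pos.le] at hx
    simp [abs_of_nonneg (Real.sin_nonneg_of_mem_Icc hx)]
  simp only [ENNReal.toReal_one, Real.rpow_one, h1] at h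
  rw [h]; norm_num

theorem interpConst_one : interpConst 1 = 16 / Real.pi ^ 2 := by
  have h := periodNorm_one_cos
  rw [periodNorm] at h
  rw [interpConst, h]
  norm_num
  ring

/-- Turns the absolute error into a relative one when `p` varies with `n`. Hölder against `‖cos‖_1 =
4` gives `‖cos‖_p ≥ 2/π`, and `(2π)^{-1/p} ≥ 1/(2π)`. -/
theorem interpConst_lower_bound {p : ℝ≥0∞} (hp : 1 ≤ p) : 4 / Real.pi ^ 4 ≤ interpConst p := by
  have hpi := Real.pi_pos
  have h2pi : (1 : ℝ) ≤ 2 * Real.pi := by nlinarith [Real.pi_gt_three]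
  have hmem : MemLp Real.cos p periodMeasure :=
    memLp_of_abs_le Real.continuous_cos Real.abs_cos_le_one
  have hs0 : 0 ≤ (p⁻¹).toReal := ENNReal.toReal_nonneg
  have hs1 : (p⁻¹).toReal ≤ 1 :=
    ENNReal.toReal_le_of_le_ofReal zero_le_one (by simpa using hp)
  have h1 := eLpNorm_le_eLpNorm_mul_rpow_measure_univ hp hmem.1
  have h2 : periodNorm 1 Real.cos ≤ periodNorm p Real.cos
      * (2 * Real.pi) ^ (1 - (p⁻¹).toReal) := by
    have h3 := ENNReal.toReal_mono (ENNReal.mul_ne_top hmem.eLpNorm_ne_top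
      (ENNReal.rpow_ne_top_of_nonneg (by
        rw [one_div p.toReal, ← ENNReal.toReal_inv]; simpa using hs1)
        (measure_ne_top _ _))) h1
    rw [ENNReal.toReal_mul, periodMeasure_univ, ← ENNReal.toReal_rpow,
      ENNReal.toReal_ofReal Real.two_pi_pos.le] at h3
    simpa [periodNorm, ENNReal.toReal_inv] using h3
  have h4 : (2 * Real.pi) ^ (1 - (p⁻¹).toReal) ≤ 2 * Real.pi := by
    simpa using Real.rpow_le_rpow_of_exponent_le h2pi (by linarith : 1 - (p⁻¹).toReal ≤ 1)
  have h5 : (2 * Real.pi)⁻¹ ≤ (2 * Real.pi) ^ (-(p⁻¹).toReal) := by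
    rw [← Real.rpow_neg_one]
    exact Real.rpow_le_rpow_of_exponent_le h2pi (by linarith)
  rw [periodNorm_one_cos] at h2
  have h6 : 2 / Real.pi ≤ periodNorm p Real.cos := by
    rw [div_le_iff₀ hpi]
    nlinarith [periodNorm_nonneg p Real.cos]
  rw [interpConst_eq, profileLimit]
  calc 4 / Real.pi ^ 4 = 2 / Real.pi * ((2 * Real.pi)⁻¹ * (2 / Real.pi) ^ 2) := by
        field_simp; norm_num
    _ ≤ _ := by gcongr

theorem isEquivalent_interpError (p : ℕ → ℝ≥0∞) (r : ℕ → ℝ) (β : ℕ → ℕ → ℝ) (hp : ∀ n, 1 ≤ p n)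
    (hlim : Tendsto (fun n : ℕ => r n / (n : ℝ)) atTop atTop) :
    Asymptotics.IsEquivalent atTop
      (fun n : ℕ => (interpError n (weylNagyClass (r n) (β n)) (p n)).toReal)
      (fun n : ℕ => (n : ℝ) ^ (-r n) * interpConst (p n)) := by
  have hexp : Tendsto (fun n : ℕ => Real.exp (-r n / ((n : ℝ) + 1))) atTop (𝓝 0) := by
    have h1 : Tendsto (fun n : ℕ => r n / ((n : ℝ) + 1)) atTop atTop := by
      refine tendsto_atTop_mono' _ ?_ (hlim.atTop_div_const two_pos)
      filter_upwards [eventually_ge_atTop 1, hlim.eventually_ge_atTop 0] with n hn hrn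
      have hn' : (1 : ℝ) ≤ n := by exact_mod_cast hn
      have hr0 : 0 ≤ r n := by
        rwa [le_div_iff₀ (by linarith), zero_mul] at hrn
      rw [div_div]
      exact div_le_div_of_nonneg_left hr0 (by linarith) (by linarith)
    simp only [neg_div]
    exact Real.tendsto_exp_neg_atTop_nhds_zero.comp h1
  have hδ : Tendsto (fun n : ℕ => 40 * (1 / (n : ℝ) + Real.exp (-r n / ((n : ℝ) + 1))))
      atTop (𝓝 0) := by
    simpa using (tendsto_one_div_atTop_nhds_zero_nat.add hexp).const_mul (40 : ℝ)
  refine Asymptotics.IsLittleO.of_bound fun c hc => ?_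
  have hc0 : 0 < 4 / Real.pi ^ 4 := by have := Real.pi_pos; positivity
  -- `r n / n ≥ 2` gives `r n ≥ 2n ≥ n + 1`, the range of the simplified estimate.
  filter_upwards [eventually_ge_atTop 1, hlim.eventually_ge_atTop 2,
    hδ.eventually_le_const (mul_pos hc hc0)] with n hn hrn hsmall
  have hn' : (1 : ℝ) ≤ n := by exact_mod_cast hn
  rw [le_div_iff₀ (by linarith)] at hrn
  have hconst := interpConst_lower_bound (hp n)
  have hw : 0 ≤ (n : ℝ) ^ (-r n) := by positivity
  refine (interpError_weylNagy_of_le (β n) (hp n) hn (by linarith)).trans ?_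
  rw [Real.norm_eq_abs, abs_of_nonneg (mul_nonneg hw (hc0.le.trans hconst))]
  calc (n : ℝ) ^ (-r n) * (40 * (1 / (n : ℝ) + Real.exp (-r n / ((n : ℝ) + 1))))
      ≤ (n : ℝ) ^ (-r n) * (c * interpConst (p n)) := by
        exact mul_le_mul_of_nonneg_left (hsmall.trans (by gcongr)) hw
    _ = _ := by ring

end TrigInterp

theorem mainTheorem3 :
    -- the estimates, with one constant `C` for all values of the parameters
    (∃ C : ℝ, 0 < C ∧
      (∀ (p : ℝ≥0∞) (r : ℝ) (β : ℕ → ℝ) (n : ℕ), 1 ≤ p → 1 < r → 1 ≤ n →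
        TrigInterp.interpError n (TrigInterp.weylNagyClass r β) p ≠ ∞ ∧
        |(TrigInterp.interpError n (TrigInterp.weylNagyClass r β) p).toReal
            - (n : ℝ) ^ (-r) * TrigInterp.interpConst p|
          ≤ (n : ℝ) ^ (-r) *
            (C * (1 / (n : ℝ) + Real.exp (-r / ((n : ℝ) + 1)) * (1 + (n : ℝ) / (r - 1))))) ∧
      (∀ (p : ℝ≥0∞) (r : ℝ) (β : ℕ → ℝ) (n : ℕ), 1 ≤ p → 1 ≤ n → (n : ℝ) + 1 ≤ r →
        |(TrigInterp.interpError n (TrigInterp.weylNagyClass r β) p).toReal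
            - (n : ℝ) ^ (-r) * TrigInterp.interpConst p|
          ≤ (n : ℝ) ^ (-r) * (C * (1 / (n : ℝ) + Real.exp (-r / ((n : ℝ) + 1))))) ∧
      (∀ (r : ℝ) (β : ℕ → ℝ) (n : ℕ), 1 ≤ n → (n : ℝ) + 1 ≤ r →
        |(TrigInterp.interpError n (TrigInterp.weylNagyClass r β) 1).toReal
            - (n : ℝ) ^ (-r) * (16 / Real.pi ^ 2)|
          ≤ (n : ℝ) ^ (-r) * (C * (1 / (n : ℝ) + Real.exp (-r / ((n : ℝ) + 1)))))) ∧
    -- asymptotic equality as `n → ∞`, `r / n → ∞`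
    (∀ (p : ℕ → ℝ≥0∞) (r : ℕ → ℝ) (β : ℕ → ℕ → ℝ), (∀ n, 1 ≤ p n) → (∀ n, 1 < r n) →
      Tendsto (fun n : ℕ => r n / (n : ℝ)) atTop atTop →
      Asymptotics.IsEquivalent atTop
        (fun n : ℕ =>
          (TrigInterp.interpError n (TrigInterp.weylNagyClass (r n) (β n)) (p n)).toReal)
        (fun n : ℕ => (n : ℝ) ^ (-r n) * TrigInterp.interpConst (p n))) ∧
    (∀ (r : ℕ → ℝ) (β : ℕ → ℕ → ℝ), (∀ n, 1 < r n) →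
      Tendsto (fun n : ℕ => r n / (n : ℝ)) atTop atTop →
      Asymptotics.IsEquivalent atTop
        (fun n : ℕ =>
          (TrigInterp.interpError n (TrigInterp.weylNagyClass (r n) (β n)) 1).toReal)
        (fun n : ℕ => (n : ℝ) ^ (-r n) * (16 / Real.pi ^ 2))) := by
  refine ⟨⟨40, by norm_num, fun p r β n hp hr hn => ?_, fun p r β n hp hn hr =>
    TrigInterp.interpError_weylNagy_of_le β hp hn hr, fun r β n hn hr => ?_⟩,
    fun p r β hp _ hlim => TrigInterp.isEquivalent_interpError p r β hp hlim,
    fun r β _ hlim => ?_⟩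
  · obtain ⟨h1, h2⟩ := TrigInterp.interpError_weylNagy (p := p) β hp hr hn
    refine ⟨h1, h2.trans ?_⟩
    have hr1 : 0 < r - 1 := by linarith
    gcongr
    norm_num
  · rw [← TrigInterp.interpConst_one]
    exact TrigInterp.interpError_weylNagy_of_le β le_rfl hn hr
  · rw [← TrigInterp.interpConst_one]
    exact TrigInterp.isEquivalent_interpError (fun _ => 1) r β (fun _ => le_rfl) hlim
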